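/- Let $G$ be a profinite group (compact, Hausdorff, totally disconnected topological group) and $R$ a ring with unit. Let $\mathcal{S}G$ be the set of closed subgroups of $G$, with the topology having as basis the sets $O(N,NK)=\{L\in\mathcal{S}G : NL=NK\}$ for $N$ an open normal subgroup and $K$ a closed subgroup of $G$, and with $G$ acting by conjugation, $g\cdot K=gKg^{-1}$. A $G$-sheaf of $R$-modules over $\mathcal{S}G$ is a $G$-equivariant local homeomorphism $p\colon E\to\mathcal{S}G$, where $E$ is a space with a continuous $G$-action, together with a left $R$-module structure on each stalk $E_K=p^{-1}(K)$, such that $(e,e')\mapsto e-e'$ is continuous on $E\times_{\mathcal{S}G}E$, each $r\in R$ acts continuously on $E$, and each $g\colon E_K\to E_{gKg^{-1}}$ is $R$-linear. A map of $G$-sheaves is a continuous $G$-equivariant map over $\mathcal{S}G$ that is $R$-linear on stalks. A Weyl-$G$-sheaf is a $G$-sheaf of $R$-modules $E$ over $\mathcal{S}G$ such that, for every $K\in\mathcal{S}G$, the subgroup $K$ acts trivially on $E_K$; these form a full subcategory, with inclusion functor $\mathrm{inc}$. For a $G$-sheaf $E$ let $\mathrm{Weyl}(E)\subseteq E$ be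 the subspace whose stalk over $K$ is the module of fixed points $E_K^K$. 1. $\mathrm{Weyl}$ is a functor from $G$-sheaves of $R$-modules over $\mathcal{S}G$ to Weyl-$G$-sheaves of $R$-modules, and it is right adjoint to $\mathrm{inc}$. The counit $\mathrm{inc}\,\mathrm{Weyl}(E)\to E$ is the inclusion of fixed points and is a monomorphism for every $E$. The unit $F\to\mathrm{Weyl}(\mathrm{inc}\,F)$ is an isomorphism for every Weyl-$G$-sheaf $F$. Hence $\mathrm{inc}\circ\mathrm{Weyl}$ is idempotent (applying it to any counit map gives an isomorphism) and $\mathrm{inc}$ is fully faithful. 2. The category of Weyl-$G$-sheaves of $R$-modules is abelian, with addition of maps given stalkwise, and it has all small limits and all small colimits. For every small diagram $F$ of Weyl-$G$-sheaves, the diagram $\mathrm{inc}\circ F$ has a limit in $G$-sheaves of $R$-modules over $\mathcal{S}G$. If $L$ is such a limit, then $\mathrm{Weyl}(L)$, with the limit projections restricted to it, is a limit of $F$. -/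

import Mathlib

open CategoryTheory CategoryTheory.Limits

universe u

/-! ### Equivariant sheaves of modules -/

/-- A `G`-equivariant sheaf of left `R`-modules over a `G`-space `X`, as a sheaf space: a
`G`-equivariant local homeomorphism `proj : carrier → X` from a space with a continuous `G`-action,
whose stalks (the fibres of `proj`) are `R`-modules such that subtraction
`carrier ×_X carrier → carrier` and multiplication by each `r : R` are continuous, and such that
each `g : G` induces `R`-linear maps from the stalk at `x` to the stalk at `g • x`. -/
structure GSheaf (G R X : Type u) [Group G] [TopologicalSpace G] [Ring R]
    [TopologicalSpace X] [MulAction G X] where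
  carrier : Type u
  [topology : TopologicalSpace carrier]
  [action : MulAction G carrier]
  [continuousAction : ContinuousSMul G carrier]
  proj : carrier → X
  isLocalHomeomorph : IsLocalHomeomorph proj
  proj_smul : ∀ (g : G) (e : carrier), proj (g • e) = g • proj e
  [addCommGroup : ∀ x : X, AddCommGroup {e : carrier // proj e = x}]
  [module : ∀ x : X, Module R {e : carrier // proj e = x}]
  continuous_sub : Continuous fun z : {z : carrier × carrier // proj z.1 = proj z.2} =>
    (((⟨z.1.1, z.2⟩ : {e : carrier // proj e = proj z.1.2}) - ⟨z.1.2, rfl⟩ :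
      {e : carrier // proj e = proj z.1.2}) : carrier)
  continuous_const_smul : ∀ r : R, Continuous fun e : carrier =>
    ((r • (⟨e, rfl⟩ : {e' : carrier // proj e' = proj e}) :
      {e' : carrier // proj e' = proj e}) : carrier)
  smul_stalk_add : ∀ (g : G) (x : X) (a b : {e : carrier // proj e = x}),
    g • ((a + b : {e : carrier // proj e = x}) : carrier) =
      (((⟨g • a.1, by rw [proj_smul, a.2]⟩ : {e : carrier // proj e = g • x}) +
        ⟨g • b.1, by rw [proj_smul, b.2]⟩ : {e : carrier // proj e = g • x}) : carrier)
  smul_stalk_smul : ∀ (g : G) (x : X) (r : R) (a : {e : carrier // proj e = x}),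
    g • ((r • a : {e : carrier // proj e = x}) : carrier) =
      ((r • (⟨g • a.1, by rw [proj_smul, a.2]⟩ : {e : carrier // proj e = g • x}) :
        {e : carrier // proj e = g • x}) : carrier)

namespace GSheaf

attribute [instance] topology action continuousAction addCommGroup module

section

variable {G R X : Type u} [Group G] [TopologicalSpace G] [Ring R]
  [TopologicalSpace X] [MulAction G X]

/-- The stalk at `x`. -/
abbrev Stalk (E : GSheaf G R X) (x : X) : Type u := {e : E.carrier // E.proj e = x}

/-- A map of `G`-sheaves of `R`-modules: a continuous `G`-equivariant map over `X` which is
`R`-linear on each stalk. -/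
@[ext]
structure Hom (E F : GSheaf G R X) where
  toFun : E.carrier → F.carrier
  continuous_toFun : Continuous toFun
  proj_toFun : ∀ e, F.proj (toFun e) = E.proj e
  smul_toFun : ∀ (g : G) (e : E.carrier), toFun (g • e) = g • toFun e
  add_toFun : ∀ (x : X) (a b : E.Stalk x), toFun ((a + b : E.Stalk x) : E.carrier) =
    (((⟨toFun a.1, by rw [proj_toFun, a.2]⟩ : F.Stalk x) +
      ⟨toFun b.1, by rw [proj_toFun, b.2]⟩ : F.Stalk x) : F.carrier)
  const_smul_toFun : ∀ (x : X) (r : R) (a : E.Stalk x),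
    toFun ((r • a : E.Stalk x) : E.carrier) =
      ((r • (⟨toFun a.1, by rw [proj_toFun, a.2]⟩ : F.Stalk x) : F.Stalk x) : F.carrier)

/-- The map induced on stalks. -/
def Hom.stalkMap {E F : GSheaf G R X} (f : E.Hom F) (x : X) : E.Stalk x →ₗ[R] F.Stalk x where
  toFun a := ⟨f.toFun a.1, by rw [f.proj_toFun, a.2]⟩
  map_add' a b := Subtype.ext (f.add_toFun x a b)
  map_smul' r a := Subtype.ext (f.const_smul_toFun x r a)

/-- The category of `G`-sheaves of `R`-modules over `X`. -/
instance category : Category.{u} (GSheaf G R X) where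
  Hom E F := E.Hom F
  id E :=
    { toFun := id
      continuous_toFun := continuous_id
      proj_toFun := fun _ => rfl
      smul_toFun := fun _ _ => rfl
      add_toFun := fun _ _ _ => rfl
      const_smul_toFun := fun _ _ _ => rfl }
  comp {E F H} f g :=
    { toFun := g.toFun ∘ f.toFun
      continuous_toFun := g.continuous_toFun.comp f.continuous_toFun
      proj_toFun := fun e => (g.proj_toFun _).trans (f.proj_toFun e)
      smul_toFun := fun a e => by simp [f.smul_toFun, g.smul_toFun]
      add_toFun := fun x a b =>
        (congrArg g.toFun (f.add_toFun x a b)).trans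
          (g.add_toFun x (f.stalkMap x a) (f.stalkMap x b))
      const_smul_toFun := fun x r a =>
        (congrArg g.toFun (f.const_smul_toFun x r a)).trans
          (g.const_smul_toFun x r (f.stalkMap x a)) }

end

end GSheaf

/-! ### The space of closed subgroups -/

namespace ClosedSubgroup

section

variable {G : Type u} [Group G] [TopologicalSpace G]

/-- The set `O(N, NK)` of closed subgroups `L` with `NL = NK`, that is, the set of those `L` which
have the same image as `K` in `G / N`. -/
def basicOpen (N : OpenNormalSubgroup G) (K : ClosedSubgroup G) : Set (ClosedSubgroup G) :=
  {L | (N : Subgroup G) ⊔ L.toSubgroup = (N : Subgroup G) ⊔ K.toSubgroup}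

/-- The topology on the set of closed subgroups with basis the sets `O(N, NK)`, for `N` an open
normal and `K` a closed subgroup. -/
instance topologicalSpace : TopologicalSpace (ClosedSubgroup G) :=
  TopologicalSpace.generateFrom
    {U | ∃ (N : OpenNormalSubgroup G) (K : ClosedSubgroup G), U = basicOpen N K}

variable [IsTopologicalGroup G]

/-- `G` acts on closed subgroups by conjugation, `g • K = g K g⁻¹`. -/
instance mulAction : MulAction G (ClosedSubgroup G) where
  smul g K :=
    { toSubgroup := K.toSubgroup.map (MulAut.conj g).toMonoidHom
      isClosed' := by
        have h : ((K.toSubgroup.map (MulAut.conj g).toMonoidHom : Subgroup G) : Set G) =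
            (fun x => g⁻¹ * x * g) ⁻¹' (K.toSubgroup : Set G) := by
          ext x
          constructor
          · rintro ⟨k, hk, rfl⟩
            simpa [mul_assoc] using hk
          · intro hx
            exact ⟨g⁻¹ * x * g, hx, by simp [mul_assoc]⟩
        change IsClosed ((K.toSubgroup.map (MulAut.conj g).toMonoidHom : Subgroup G) : Set G)
        rw [h]
        exact K.isClosed'.preimage (by fun_prop) }
  one_smul K := by
    apply ClosedSubgroup.toSubgroup_injective
    change K.toSubgroup.map (MulAut.conj (1 : G)).toMonoidHom = K.toSubgroup
    ext x
    simp
  mul_smul g h K := by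
    apply ClosedSubgroup.toSubgroup_injective
    change K.toSubgroup.map (MulAut.conj (g * h)).toMonoidHom =
      (K.toSubgroup.map (MulAut.conj h).toMonoidHom).map (MulAut.conj g).toMonoidHom
    rw [Subgroup.map_map, map_mul]
    rfl

theorem smul_toSubgroup (g : G) (K : ClosedSubgroup G) :
    (g • K).toSubgroup = K.toSubgroup.map (MulAut.conj g).toMonoidHom := rfl

theorem mem_smul_iff (g : G) (K : ClosedSubgroup G) (x : G) :
    x ∈ g • K ↔ g⁻¹ * x * g ∈ K := by
  change x ∈ K.toSubgroup.map (MulAut.conj g).toMonoidHom ↔ _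
  constructor
  · rintro ⟨k, hk, rfl⟩
    have : k ∈ K := hk
    simpa [mul_assoc] using this
  · intro hx
    exact ⟨g⁻¹ * x * g, hx, by simp [mul_assoc]⟩

theorem smul_eq_self_of_mem {K : ClosedSubgroup G} {k : G} (hk : k ∈ K) : k • K = K := by
  ext x
  change x ∈ k • K ↔ x ∈ K
  rw [mem_smul_iff]
  constructor
  · intro h
    have := mul_mem (mul_mem hk h) (inv_mem hk)
    simpa [mul_assoc] using this
  · intro h
    exact mul_mem (mul_mem (inv_mem hk) h) hk

/-- In a profinite group the closed subgroups contained in a given open set form an open set. -/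
theorem isOpen_setOf_subset [CompactSpace G] [TotallyDisconnectedSpace G]
    {W : Set G} (hW : IsOpen W) : IsOpen {L : ClosedSubgroup G | (L : Set G) ⊆ W} := by
  rw [isOpen_iff_forall_mem_open]
  intro K hK
  have hc : IsCompact (K : Set G) := K.isClosed'.isCompact
  obtain ⟨V, hV, hVK⟩ := compact_open_separated_mul_left hc hW hK
  obtain ⟨U, hUV, hUo, hU1⟩ := mem_nhds_iff.1 hV
  obtain ⟨N, hN⟩ := ProfiniteGrp.exist_openNormalSubgroup_sub_open_nhds_of_one hUo hU1
  refine ⟨basicOpen N K, ?_, TopologicalSpace.isOpen_generateFrom_of_mem ⟨N, K, rfl⟩, rfl⟩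
  intro L hL x hx
  have hx' : x ∈ (N : Subgroup G) ⊔ L.toSubgroup := (le_sup_right : _ ≤ (N : Subgroup G) ⊔ _) hx
  rw [show (N : Subgroup G) ⊔ L.toSubgroup = (N : Subgroup G) ⊔ K.toSubgroup from hL] at hx'
  obtain ⟨n, hn, k, hk, rfl⟩ := Subgroup.mem_sup_of_normal_left.1 hx'
  exact hVK (Set.mul_mem_mul (hUV (hN hn)) hk)

end

end ClosedSubgroup

/-! ### Weyl sheaves -/

section

variable {G R : Type u} [Group G] [TopologicalSpace G] [IsTopologicalGroup G] [Ring R]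

/-- A `G`-sheaf over the space of closed subgroups is a Weyl-`G`-sheaf if its stalk over each
closed subgroup `K` is fixed pointwise by `K`. -/
def GSheaf.IsWeyl : ObjectProperty (GSheaf G R (ClosedSubgroup G)) := fun E =>
  ∀ (K : ClosedSubgroup G) (e : E.Stalk K), ∀ k ∈ K, k • e.1 = e.1

variable (G R) in
/-- The category of Weyl-`G`-sheaves of `R`-modules: a full subcategory of the category of
`G`-sheaves of `R`-modules over the space of closed subgroups. -/
abbrev WeylSheaf : Type (u + 1) :=
  (GSheaf.IsWeyl : ObjectProperty (GSheaf G R (ClosedSubgroup G))).FullSubcategory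

variable (G R) in
/-- The inclusion of Weyl-`G`-sheaves into `G`-sheaves. -/
abbrev WeylSheaf.inc : WeylSheaf G R ⥤ GSheaf G R (ClosedSubgroup G) :=
  ObjectProperty.ι _

namespace GSheaf

/-- A point of the sheaf space over `K` is Weyl-fixed if it is fixed by `K`. -/
def IsFixed (E : GSheaf G R (ClosedSubgroup G)) (e : E.carrier) : Prop :=
  ∀ k ∈ E.proj e, k • e = e

theorem isFixed_iff (E : GSheaf G R (ClosedSubgroup G)) {K : ClosedSubgroup G} (e : E.Stalk K) :
    E.IsFixed e.1 ↔ ∀ k ∈ K, k • e.1 = e.1 := by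
  obtain ⟨e, rfl⟩ := e
  rfl

theorem IsFixed.smul {E : GSheaf G R (ClosedSubgroup G)} {e : E.carrier} (he : E.IsFixed e)
    (g : G) : E.IsFixed (g • e) := by
  intro k hk
  rw [E.proj_smul, ClosedSubgroup.mem_smul_iff] at hk
  have h := congrArg (fun z => g • z) (he _ hk)
  simpa [smul_smul, mul_assoc] using h

theorem IsFixed.map {E F : GSheaf G R (ClosedSubgroup G)} (f : E ⟶ F) {e : E.carrier}
    (he : E.IsFixed e) : F.IsFixed (Hom.toFun f e) := by
  intro k hk
  rw [Hom.proj_toFun f] at hk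
  rw [← Hom.smul_toFun f, he k hk]

/-- The `R`-submodule `E_K ^ K` of `K`-fixed points of the stalk over `K`. -/
def fixedStalk (E : GSheaf G R (ClosedSubgroup G)) (K : ClosedSubgroup G) :
    Submodule R (E.Stalk K) where
  carrier := {e | E.IsFixed e.1}
  add_mem' := by
    intro a b ha hb
    refine (E.isFixed_iff _).2 fun k hk => ?_
    rw [E.smul_stalk_add]
    have h1 := (E.isFixed_iff a).1 ha k hk
    have h2 := (E.isFixed_iff b).1 hb k hk
    have key : ∀ (K' : ClosedSubgroup G) (_ : K' = K) (a' b' : E.Stalk K'), a'.1 = a.1 →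
        b'.1 = b.1 → (a' + b' : E.Stalk K').1 = (a + b : E.Stalk K).1 := by
      rintro K' rfl a' b' ha' hb'
      rw [Subtype.ext ha', Subtype.ext hb']
    exact key _ (ClosedSubgroup.smul_eq_self_of_mem hk) _ _ h1 h2
  smul_mem' := by
    intro r a ha
    refine (E.isFixed_iff _).2 fun k hk => ?_
    rw [E.smul_stalk_smul]
    have h1 := (E.isFixed_iff a).1 ha k hk
    have key : ∀ (K' : ClosedSubgroup G) (_ : K' = K) (a' : E.Stalk K'), a'.1 = a.1 →
        (r • a' : E.Stalk K').1 = (r • a : E.Stalk K).1 := by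
      rintro K' rfl a' ha'
      rw [Subtype.ext ha']
    exact key _ (ClosedSubgroup.smul_eq_self_of_mem hk) _ h1
  zero_mem' := by
    refine (E.isFixed_iff _).2 fun k hk => ?_
    have h0 : ((0 : E.Stalk K) : E.carrier) = (((0 : R) • (0 : E.Stalk K) : E.Stalk K)).1 := by
      rw [zero_smul]
    have key : ∀ (K' : ClosedSubgroup G) (_ : K' = K) (a' : E.Stalk K'),
        ((0 : R) • a' : E.Stalk K').1 = ((0 : E.Stalk K)).1 := by
      rintro K' rfl a'
      rw [zero_smul]
    conv_lhs => rw [h0]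
    rw [E.smul_stalk_smul]
    exact key _ (ClosedSubgroup.smul_eq_self_of_mem hk) _

/-- The fixed points of all stalks form an open subset of the sheaf space. -/
theorem isOpen_isFixed [CompactSpace G] [TotallyDisconnectedSpace G]
    (E : GSheaf G R (ClosedSubgroup G)) : IsOpen {e | E.IsFixed e} := by
  rw [isOpen_iff_forall_mem_open]
  intro e he
  obtain ⟨φ, heφ, hφ⟩ := E.isLocalHomeomorph e
  have hcont : Continuous fun z : G × E.carrier => z.1 • z.2 := continuous_smul
  obtain ⟨W, V, hW, hV, hKW, heV, hWV⟩ := generalized_tube_lemma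
    (s := (E.proj e : Set G)) (E.proj e).isClosed'.isCompact
    (isCompact_singleton (x := e)) (φ.open_source.preimage hcont) (by
      rintro ⟨k, x⟩ ⟨hk, hx⟩
      have hx : x = e := hx
      subst hx
      change k • x ∈ φ.source
      rwa [he k hk])
  refine ⟨(V ∩ φ.source) ∩ E.proj ⁻¹' {L | (L : Set G) ⊆ W}, ?_, ?_,
    ⟨heV rfl, heφ⟩, hKW⟩
  · rintro x ⟨⟨hxV, hxφ⟩, hxW⟩ l hl
    have h1 : l • x ∈ φ.source := hWV (show (l, x) ∈ W ×ˢ V from ⟨hxW hl, hxV⟩)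
    refine φ.injOn h1 hxφ ?_
    rw [← hφ, E.proj_smul, ClosedSubgroup.smul_eq_self_of_mem hl]
  · exact (hV.inter φ.open_source).inter
      ((ClosedSubgroup.isOpen_setOf_subset hW).preimage E.isLocalHomeomorph.continuous)

/-- The fibre over `K` of the space of fixed points is `E_K ^ K`. -/
def fixedFibreEquiv (E : GSheaf G R (ClosedSubgroup G)) (K : ClosedSubgroup G) :
    {e : {e : E.carrier // E.IsFixed e} // E.proj e.1 = K} ≃ E.fixedStalk K where
  toFun e := ⟨⟨e.1.1, e.2⟩, e.1.2⟩
  invFun e := ⟨⟨e.1.1, e.2⟩, e.1.2⟩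
  left_inv _ := rfl
  right_inv _ := rfl

variable [CompactSpace G] [TotallyDisconnectedSpace G]

/-- The `G`-sheaf with stalks `E_K ^ K`, topologised as a subspace of the sheaf space of `E`. -/
def fixed (E : GSheaf G R (ClosedSubgroup G)) : GSheaf G R (ClosedSubgroup G) :=
  letI : ∀ K : ClosedSubgroup G,
      AddCommGroup {e : {e : E.carrier // E.IsFixed e} // E.proj e.1 = K} :=
    fun K => (E.fixedFibreEquiv K).addCommGroup
  letI : ∀ K : ClosedSubgroup G,
      Module R {e : {e : E.carrier // E.IsFixed e} // E.proj e.1 = K} :=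
    fun K => (E.fixedFibreEquiv K).module R
  letI : MulAction G {e : E.carrier // E.IsFixed e} :=
    { smul := fun g e => ⟨g • e.1, e.2.smul g⟩
      one_smul := fun e => Subtype.ext (one_smul G e.1)
      mul_smul := fun g h e => Subtype.ext (mul_smul g h e.1) }
  { carrier := {e : E.carrier // E.IsFixed e}
    continuousAction :=
      ⟨Continuous.subtype_mk
        (continuous_smul.comp (continuous_fst.prodMk (continuous_subtype_val.comp continuous_snd)))
        _⟩
    proj := fun e => E.proj e.1
    isLocalHomeomorph :=
      E.isLocalHomeomorph.comp
        (Topology.IsOpenEmbedding.isLocalHomeomorph E.isOpen_isFixed.isOpenEmbedding_subtypeVal)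
    proj_smul := fun g e => E.proj_smul g e.1
    continuous_sub := by
      refine Continuous.subtype_mk (p := fun e => E.IsFixed e) ?_ _
      exact E.continuous_sub.comp
        (Continuous.subtype_mk ((continuous_subtype_val.comp (continuous_fst.comp
          continuous_subtype_val)).prodMk (continuous_subtype_val.comp (continuous_snd.comp
          continuous_subtype_val))) fun z => z.2)
    continuous_const_smul := fun r => by
      refine Continuous.subtype_mk (p := fun e => E.IsFixed e) ?_ _
      exact (E.continuous_const_smul r).comp continuous_subtype_val
    smul_stalk_add := fun g K a b => Subtype.ext
      (E.smul_stalk_add g K ⟨a.1.1, a.2⟩ ⟨b.1.1, b.2⟩)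
    smul_stalk_smul := fun g K r a => Subtype.ext (E.smul_stalk_smul g K r ⟨a.1.1, a.2⟩) }

theorem isWeyl_fixed (E : GSheaf G R (ClosedSubgroup G)) : E.fixed.IsWeyl := by
  rintro K ⟨e, rfl⟩ k hk
  exact Subtype.ext (e.2 k hk)

/-- The inclusion of the fixed points. -/
def fixedIncl (E : GSheaf G R (ClosedSubgroup G)) : E.fixed ⟶ E :=
  show E.fixed.Hom E from
  { toFun := fun e => e.1
    continuous_toFun := continuous_subtype_val
    proj_toFun := fun _ => rfl
    smul_toFun := fun _ _ => rfl
    add_toFun := fun _ _ _ => rfl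
    const_smul_toFun := fun _ _ _ => rfl }

/-- A map of `G`-sheaves restricts to fixed points. -/
def fixedMap {E F : GSheaf G R (ClosedSubgroup G)} (f : E ⟶ F) : E.fixed ⟶ F.fixed :=
  show E.fixed.Hom F.fixed from
  { toFun := fun e => ⟨Hom.toFun f e.1, e.2.map f⟩
    continuous_toFun := ((Hom.continuous_toFun f).comp continuous_subtype_val).subtype_mk _
    proj_toFun := fun e => Hom.proj_toFun f e.1
    smul_toFun := fun g e => Subtype.ext (Hom.smul_toFun f g e.1)
    add_toFun := fun K a b => Subtype.ext (Hom.add_toFun f K ⟨a.1.1, a.2⟩ ⟨b.1.1, b.2⟩)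
    const_smul_toFun := fun K r a => Subtype.ext (Hom.const_smul_toFun f K r ⟨a.1.1, a.2⟩) }

end GSheaf

variable [CompactSpace G] [TotallyDisconnectedSpace G]

variable (G R) in
/-- The functor `Weyl`, which takes `K`-fixed points of the stalk over each `K`. -/
def weyl : GSheaf G R (ClosedSubgroup G) ⥤ WeylSheaf G R where
  obj E := ⟨E.fixed, E.isWeyl_fixed⟩
  map f := ObjectProperty.homMk (GSheaf.fixedMap f)
  map_id _ := rfl
  map_comp _ _ := rfl

/-- For a diagram `F` of Weyl-`G`-sheaves and a cone `c` over the underlying diagram of `G`-sheaves,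
the cone over `F` with apex `Weyl c.pt` and with the legs of `c` restricted to fixed points. -/
def weylCone {J : Type u} [SmallCategory J] {F : J ⥤ WeylSheaf G R}
    (c : Cone (F ⋙ WeylSheaf.inc G R)) : Cone F where
  pt := (weyl G R).obj c.pt
  π :=
    { app := fun j => ObjectProperty.homMk (c.pt.fixedIncl ≫ c.π.app j)
      naturality := fun i j a => by
        apply ObjectProperty.hom_ext
        have h := c.w a
        change 𝟙 _ ≫ (c.pt.fixedIncl ≫ c.π.app j) =
          (c.pt.fixedIncl ≫ c.π.app i) ≫ (F ⋙ WeylSheaf.inc G R).map a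
        rw [Category.id_comp, Category.assoc, h] }

end

/-! ### Local homeomorphisms -/

/-! The adjunction is formal. Being fixed by `K` is an open condition on the sheaf space
(`GSheaf.isOpen_isFixed`), and equivariant maps out of a Weyl sheaf land in the fixed points. The
unit is invertible because the inclusion is fully faithful, and limits of Weyl sheaves are computed
by transposing along the adjunction.

The substance is the existence of limits, colimits and the abelian structure. For a family of
subsets `S x` of `G` with enough charts, the `G`-sheaves on whose stalks `S x` acts trivially form a
reflective subcategory of the presheaves of modules on a small category of charts, which are open
stable subsets of `(G ⧸ M) × X` with `M` open. A sheaf gives its equivariant sections over charts, a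
presheaf gives its space of germs (`Germ.sheaf`). The counit is bijective because charts cover every
étale `G`-space fixed by `S` (`HasCharts`). Equalities of germs are equalities on a refinement, so
sheafification preserves kernels; being additive, it is left exact. All the structure then descends
from presheaves.

Charts over the space of closed subgroups come from compactness (`ClosedSubgroup.hasCharts`): a
local section through a point over `K` fixed by `A K` is equivariant under `N·A(K)` over `O(N, NK)`
for small `N`, and spreads out over `G`. Taking `A K = K` gives Weyl sheaves; taking `A K` trivial
gives all `G`-sheaves, whose limits are also needed. -/

theorem IsLocallyInjective.isLocalHomeomorph {Y Z : Type*} [TopologicalSpace Y]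
    [TopologicalSpace Z] {f : Y → Z} (hc : Continuous f) (ho : IsOpenMap f)
    (hi : IsLocallyInjective f) : IsLocalHomeomorph f := by
  refine isLocalHomeomorph_iff_isOpenEmbedding_restrict.2 fun y => ?_
  obtain ⟨U, hU, hy, hinj⟩ := hi y
  exact ⟨U, hU.mem_nhds hy, .of_continuous_injective_isOpenMap
    (hc.comp continuous_subtype_val) (Set.injOn_iff_injective.1 hinj)
    (ho.comp hU.isOpenMap_subtype_val)⟩

/-- The image of a box `A × B` is `A ∩ f⁻¹(g(B))`, and points with the same first coordinate have
second coordinates with the same image under the locally injective `g`. -/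
theorem IsLocalHomeomorph.pullback_fst {Y Y' Z : Type*} [TopologicalSpace Y]
    [TopologicalSpace Y'] [TopologicalSpace Z] {f : Y → Z} {g : Y' → Z} (hf : Continuous f)
    (hg : IsLocalHomeomorph g) :
    IsLocalHomeomorph fun p : {p : Y × Y' // f p.1 = g p.2} => p.1.1 := by
  refine IsLocallyInjective.isLocalHomeomorph (by fun_prop) ?_ ?_
  · rintro W hW
    obtain ⟨V, hV, rfl⟩ := isOpen_induced_iff.1 hW
    rw [isOpen_iff_forall_mem_open]
    rintro _ ⟨⟨⟨y, y'⟩, h⟩, hy, rfl⟩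
    obtain ⟨A, B, hA, hB, hyA, hyB, hAB⟩ := isOpen_prod_iff.1 hV y y' hy
    refine ⟨A ∩ f ⁻¹' (g '' B), ?_, hA.inter ((hg.isOpenMap B hB).preimage hf), hyA,
      ⟨y', hyB, h.symm⟩⟩
    rintro z ⟨hz, b, hb, hzb⟩
    exact ⟨⟨(z, b), hzb.symm⟩, hAB ⟨hz, hb⟩, rfl⟩
  · rintro ⟨⟨y, y'⟩, h⟩
    obtain ⟨B, hB, hyB, hinj⟩ := hg.isLocallyInjective y'
    refine ⟨{p | p.1.2 ∈ B}, hB.preimage (by fun_prop), hyB, ?_⟩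
    rintro ⟨⟨a, b⟩, hab⟩ hb ⟨⟨a', b'⟩, hab'⟩ hb' (rfl : a = a')
    obtain rfl : b = b' := hinj hb hb' (hab.symm.trans hab')
    rfl

/-- If `p ∘ q` is injective on an open set, then `p` is injective on the image of that set under
`q`, which is again open. -/
theorem IsLocalHomeomorph.of_comp_isOpenQuotientMap {Y Z W : Type*} [TopologicalSpace Y]
    [TopologicalSpace Z] [TopologicalSpace W] {q : Y → Z} {p : Z → W} (hq : IsOpenQuotientMap q)
    (hpq : IsLocalHomeomorph (p ∘ q)) : IsLocalHomeomorph p := by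
  refine IsLocallyInjective.isLocalHomeomorph (hq.continuous_comp_iff.1 hpq.continuous)
    (hq.isOpenMap_iff.2 hpq.isOpenMap) fun z => ?_
  obtain ⟨y, rfl⟩ := hq.surjective z
  obtain ⟨U, hU, hy, hinj⟩ := hpq.isLocallyInjective y
  refine ⟨q '' U, hq.isOpenMap U hU, ⟨y, hy, rfl⟩, ?_⟩
  rintro _ ⟨a, ha, rfl⟩ _ ⟨b, hb, rfl⟩ hab
  rw [hinj ha hb hab]

theorem IsLocalHomeomorph.sigma {ι : Type*} {Y : ι → Type*} {Z : Type*}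
    [∀ i, TopologicalSpace (Y i)] [TopologicalSpace Z] {f : ∀ i, Y i → Z}
    (hf : ∀ i, IsLocalHomeomorph (f i)) :
    IsLocalHomeomorph fun y : Σ i, Y i => f y.1 y.2 := by
  refine IsLocallyInjective.isLocalHomeomorph (continuous_sigma fun i => (hf i).continuous)
    (isOpenMap_sigma.2 fun i => (hf i).isOpenMap) ?_
  rintro ⟨i, y⟩
  obtain ⟨U, hU, hy, hinj⟩ := (hf i).isLocallyInjective y
  refine ⟨Sigma.mk i '' U, isOpenMap_sigmaMk U hU, ⟨y, hy, rfl⟩, ?_⟩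
  rintro _ ⟨a, ha, rfl⟩ _ ⟨b, hb, rfl⟩ hab
  rw [hinj ha hb hab]

/-- Operations on spaces of germs are tested for continuity in this way, along local sections. -/
theorem IsLocalHomeomorph.continuousAt_of_comp {Y Z W : Type*} [TopologicalSpace Y]
    [TopologicalSpace Z] [TopologicalSpace W] {q : Y → Z} {f : Z → W} (hq : IsLocalHomeomorph q)
    (h : Continuous (f ∘ q)) (y : Y) : ContinuousAt f (q y) := by
  rw [ContinuousAt, ← hq.map_nhds_eq y, Filter.tendsto_map'_iff]
  exact h.tendsto y

/-! ### Equivariant sheaves of sets -/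

/-- A `G`-equivariant local homeomorphism to a `G`-space `X`, from a space with a continuous
`G`-action. -/
structure EtaleGSpace (G X : Type u) [Group G] [TopologicalSpace G] [TopologicalSpace X]
    [MulAction G X] where
  carrier : Type u
  [topology : TopologicalSpace carrier]
  [action : MulAction G carrier]
  [continuousAction : ContinuousSMul G carrier]
  proj : carrier → X
  isLocalHomeomorph : IsLocalHomeomorph proj
  proj_smul : ∀ (g : G) (e : carrier), proj (g • e) = g • proj e

namespace EtaleGSpace

attribute [instance] topology action continuousAction

variable {G X : Type u} [Group G] [TopologicalSpace G] [TopologicalSpace X] [MulAction G X]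

/-- Continuous equivariant maps over `X`. -/
@[ext]
structure Hom (Y Z : EtaleGSpace G X) where
  toFun : Y.carrier → Z.carrier
  continuous_toFun : Continuous toFun
  proj_toFun : ∀ y, Z.proj (toFun y) = Y.proj y
  smul_toFun : ∀ (g : G) (y : Y.carrier), toFun (g • y) = g • toFun y

variable {Y Y' Z : EtaleGSpace G X}

theorem Hom.isLocalHomeomorph (f : Hom Y Z) : IsLocalHomeomorph f.toFun :=
  IsLocalHomeomorph.of_comp
    (by rw [show Z.proj ∘ f.toFun = Y.proj from funext f.proj_toFun]; exact Y.isLocalHomeomorph)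
    Z.isLocalHomeomorph f.continuous_toFun

/-- The identity. -/
def Hom.id (Y : EtaleGSpace G X) : Hom Y Y :=
  ⟨_root_.id, continuous_id, fun _ => rfl, fun _ _ => rfl⟩

/-- Composition, in diagrammatic order. -/
def Hom.comp (f : Hom Y Y') (g : Hom Y' Z) : Hom Y Z where
  toFun := g.toFun ∘ f.toFun
  continuous_toFun := g.continuous_toFun.comp f.continuous_toFun
  proj_toFun y := (g.proj_toFun _).trans (f.proj_toFun y)
  smul_toFun a y := by simp [f.smul_toFun, g.smul_toFun]

/-- The stabilisers of the points of `Y` contain the given subsets of `G`. -/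
def FixedBy (S : X → Set G) (Y : EtaleGSpace G X) : Prop :=
  ∀ y, ∀ k ∈ S (Y.proj y), k • y = y

/-- The fibre product of `Y` and `Y'` over `Z`. -/
def pullback (f : Hom Y Z) (g : Hom Y' Z) : EtaleGSpace G X :=
  letI : MulAction G {p : Y.carrier × Y'.carrier // f.toFun p.1 = g.toFun p.2} :=
    { smul := fun a p => ⟨(a • p.1.1, a • p.1.2), by
        rw [f.smul_toFun, g.smul_toFun, p.2]⟩
      one_smul := fun p => Subtype.ext (one_smul G p.1)
      mul_smul := fun a b p => Subtype.ext (mul_smul a b p.1) }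
  { carrier := {p : Y.carrier × Y'.carrier // f.toFun p.1 = g.toFun p.2}
    continuousAction := ⟨Continuous.subtype_mk
      (f := fun z : G × {p : Y.carrier × Y'.carrier // f.toFun p.1 = g.toFun p.2} =>
        (z.1 • z.2.1.1, z.1 • z.2.1.2)) (by fun_prop) _⟩
    proj := fun p => Y.proj p.1.1
    isLocalHomeomorph := Y.isLocalHomeomorph.comp
      (IsLocalHomeomorph.pullback_fst f.continuous_toFun g.isLocalHomeomorph)
    proj_smul := fun a p => Y.proj_smul a p.1.1 }

/-- The first projection. -/
def pullbackFst (f : Hom Y Z) (g : Hom Y' Z) : Hom (pullback f g) Y where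
  toFun p := p.1.1
  continuous_toFun := continuous_fst.comp continuous_subtype_val
  proj_toFun _ := rfl
  smul_toFun _ _ := rfl

/-- The second projection. -/
def pullbackSnd (f : Hom Y Z) (g : Hom Y' Z) : Hom (pullback f g) Y' where
  toFun p := p.1.2
  continuous_toFun := continuous_snd.comp continuous_subtype_val
  proj_toFun p := by
    change Y'.proj p.1.2 = Y.proj p.1.1
    rw [← g.proj_toFun, ← f.proj_toFun, p.2]
  smul_toFun _ _ := rfl

/-- The map to the fibre product given by a pair of maps. -/
def pullbackLift {W : EtaleGSpace G X} {f : Hom Y Z} {g : Hom Y' Z} (a : Hom W Y) (b : Hom W Y')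
    (h : ∀ w, f.toFun (a.toFun w) = g.toFun (b.toFun w)) : Hom W (pullback f g) where
  toFun w := ⟨(a.toFun w, b.toFun w), h w⟩
  continuous_toFun := (a.continuous_toFun.prodMk b.continuous_toFun).subtype_mk _
  proj_toFun := a.proj_toFun
  smul_toFun k w := Subtype.ext (Prod.ext (a.smul_toFun k w) (b.smul_toFun k w))

theorem FixedBy.pullback {S : X → Set G} {f : Hom Y Z} {g : Hom Y' Z} (hY : Y.FixedBy S)
    (hY' : Y'.FixedBy S) : (pullback f g).FixedBy S := fun p k hk =>
  Subtype.ext (Prod.ext (hY _ k hk) (hY' p.1.2 k (by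
    rwa [show Y'.proj p.1.2 = _ from (pullbackSnd f g).proj_toFun p])))

variable (G X) in
/-- The base, as a space over itself. -/
def base [ContinuousSMul G X] : EtaleGSpace G X where
  carrier := X
  proj := _root_.id
  isLocalHomeomorph := (Homeomorph.refl X).isLocalHomeomorph
  proj_smul _ _ := rfl

/-- The structure map of `Y`. -/
def toBase [ContinuousSMul G X] (Y : EtaleGSpace G X) : Hom Y (base G X) where
  toFun := Y.proj
  continuous_toFun := Y.isLocalHomeomorph.continuous
  proj_toFun _ := rfl
  smul_toFun := Y.proj_smul

end EtaleGSpace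

/-! ### Charts -/

section

variable {G X : Type u} [Group G] [TopologicalSpace G] [TopologicalSpace X] [MulAction G X]

/-- A chart: an open `G`-stable subset of `(G ⧸ M) × X`, with `M` an open subgroup, whose points
over `x` are fixed by `S x`. -/
structure Chart (S : X → Set G) where
  level : OpenSubgroup G
  domain : Set ((G ⧸ level.toSubgroup) × X)
  isOpen_domain : IsOpen domain
  smul_mem : ∀ (g : G), ∀ p ∈ domain, g • p ∈ domain
  fixed : ∀ p ∈ domain, ∀ k ∈ S p.2, k • p = p

namespace Chart

variable [IsTopologicalGroup G] [ContinuousSMul G X] {S : X → Set G}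

/-- The étale space of a chart. -/
def space (c : Chart S) : EtaleGSpace G X :=
  letI : MulAction G c.domain :=
    { smul := fun g p => ⟨g • p.1, c.smul_mem g p.1 p.2⟩
      one_smul := fun p => Subtype.ext (one_smul G p.1)
      mul_smul := fun a b p => Subtype.ext (mul_smul a b p.1) }
  { carrier := c.domain
    continuousAction := ⟨Continuous.subtype_mk
      (f := fun z : G × c.domain => z.1 • z.2.1) (by fun_prop) _⟩
    proj := fun p => p.1.2
    isLocalHomeomorph := by
      refine IsLocallyInjective.isLocalHomeomorph (by fun_prop)
        (isOpenMap_snd.comp c.isOpen_domain.isOpenMap_subtype_val) fun p => ?_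
      refine ⟨{q | q.1.1 = p.1.1},
        (isOpen_discrete {p.1.1}).preimage (continuous_fst.comp continuous_subtype_val), rfl, ?_⟩
      intro a ha b hb hab
      exact Subtype.ext (Prod.ext (Eq.trans ha (Eq.symm hb)) hab)
    proj_smul := fun _ _ => rfl }

theorem fixedBy_space (c : Chart S) : c.space.FixedBy S := fun p k hk =>
  Subtype.ext (c.fixed p.1 p.2 k hk)

instance : Category.{u} (Chart S) where
  Hom c d := EtaleGSpace.Hom c.space d.space
  id c := EtaleGSpace.Hom.id c.space
  comp f g := EtaleGSpace.Hom.comp f g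

end Chart

/-- There are enough charts: every étale `G`-space over `X` whose points over `x` are fixed by
`S x` is covered by charts. -/
class HasCharts [IsTopologicalGroup G] [ContinuousSMul G X] (S : X → Set G) : Prop where
  smul_eq : ∀ x, ∀ k ∈ S x, k • x = x
  exists_chart : ∀ Y : EtaleGSpace G X, Y.FixedBy S → ∀ y : Y.carrier,
    ∃ (c : Chart S) (t : c.space.carrier) (f : EtaleGSpace.Hom c.space Y), f.toFun t = y

namespace Chart

variable [IsTopologicalGroup G] [ContinuousSMul G X] {S : X → Set G} [HasCharts S]

/-- The points of a chart. -/
abbrev Pt (c : Chart S) : Type u := c.space.carrier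

/-- A map of charts, on points. -/
abbrev app {c d : Chart S} (f : c ⟶ d) : c.Pt → d.Pt := EtaleGSpace.Hom.toFun f

/-- The fibre product of two charts is an étale space fixed by `S`, so some chart hits any given
point of it. This replaces fibre products in the category of charts. -/
theorem exists_pullback {c d : Chart S} {Z : EtaleGSpace G X} (f : EtaleGSpace.Hom c.space Z)
    (g : EtaleGSpace.Hom d.space Z) (t : c.Pt) (t' : d.Pt) (h : f.toFun t = g.toFun t') :
    ∃ (e : Chart S) (w : e.Pt) (a : e ⟶ c) (b : e ⟶ d), app a w = t ∧ app b w = t' ∧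
      ∀ z, f.toFun (app a z) = g.toFun (app b z) := by
  obtain ⟨e, w, p, hp⟩ := HasCharts.exists_chart (S := S) (EtaleGSpace.pullback f g)
    (c.fixedBy_space.pullback d.fixedBy_space) ⟨(t, t'), h⟩
  refine ⟨e, w, p.comp (EtaleGSpace.pullbackFst f g), p.comp (EtaleGSpace.pullbackSnd f g),
    ?_, ?_, fun z => (p.toFun z).2⟩
  · exact congrArg (fun z => z.1.1) hp
  · exact congrArg (fun z => z.1.2) hp

theorem exists_pullback_hom {c d k : Chart S} (f : c ⟶ k) (g : d ⟶ k) (t : c.Pt) (t' : d.Pt)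
    (h : app f t = app g t') :
    ∃ (e : Chart S) (w : e.Pt) (a : e ⟶ c) (b : e ⟶ d), app a w = t ∧ app b w = t' ∧
      a ≫ f = b ≫ g := by
  obtain ⟨e, w, a, b, ha, hb, hab⟩ := exists_pullback (S := S) (Z := k.space) f g t t' h
  exact ⟨e, w, a, b, ha, hb, EtaleGSpace.Hom.ext (funext hab)⟩

theorem exists_prod {c d : Chart S} (t : c.Pt) (t' : d.Pt) (h : c.space.proj t = d.space.proj t') :
    ∃ (e : Chart S) (w : e.Pt) (a : e ⟶ c) (b : e ⟶ d), app a w = t ∧ app b w = t' := by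
  obtain ⟨e, w, a, b, ha, hb, -⟩ := exists_pullback (S := S) c.space.toBase d.space.toBase t t' h
  exact ⟨e, w, a, b, ha, hb⟩

/-- The equaliser is the fibre product of `(f, g)` and the diagonal over `d ×_X d`. -/
theorem exists_equalizer {c d : Chart S} (f g : c ⟶ d) (t : c.Pt) (h : app f t = app g t) :
    ∃ (e : Chart S) (w : e.Pt) (a : e ⟶ c), app a w = t ∧ a ≫ f = a ≫ g := by
  have hproj : ∀ z, d.space.proj (app f z) = d.space.proj (app g z) := fun z => by
    rw [EtaleGSpace.Hom.proj_toFun f, EtaleGSpace.Hom.proj_toFun g]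
  obtain ⟨e, w, a, b, ha, -, hab⟩ := exists_pullback (S := S)
    (EtaleGSpace.pullbackLift (f := d.space.toBase) (g := d.space.toBase) f g hproj)
    (EtaleGSpace.pullbackLift (f := d.space.toBase) (g := d.space.toBase)
      (EtaleGSpace.Hom.id _) (EtaleGSpace.Hom.id _) fun _ => rfl) t (app f t)
    (Subtype.ext (Prod.ext rfl h.symm))
  refine ⟨e, w, a, ha, EtaleGSpace.Hom.ext (funext fun z => ?_)⟩
  exact (congrArg (fun p => p.1.1) (hab z)).trans (congrArg (fun p => p.1.2) (hab z)).symm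

variable (S) in
-- The base is an étale space over itself, fixed by `S` because of `smul_eq`.
theorem exists_pt (x : X) : ∃ (c : Chart S) (t : c.Pt), c.space.proj t = x := by
  obtain ⟨c, t, f, h⟩ := HasCharts.exists_chart (S := S) (EtaleGSpace.base G X)
    (HasCharts.smul_eq (S := S)) x
  exact ⟨c, t, (f.proj_toFun t).symm.trans h⟩

end Chart

end

/-! ### Sections of a `G`-sheaf -/

namespace GSheaf

section

variable {G R X : Type u} [Group G] [TopologicalSpace G] [Ring R]
  [TopologicalSpace X] [MulAction G X] (E F : GSheaf G R X)

/-- The underlying étale space. -/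
def toEtale : EtaleGSpace G X where
  carrier := E.carrier
  proj := E.proj
  isLocalHomeomorph := E.isLocalHomeomorph
  proj_smul := E.proj_smul

variable {E}

/-- Stalks over propositionally equal points are different types; comparing values in the sheaf
space avoids transport. -/
theorem coe_add_congr {x y : X} {a b : E.Stalk x} {a' b' : E.Stalk y} (ha : a.1 = a'.1)
    (hb : b.1 = b'.1) : (a + b).1 = (a' + b').1 := by
  obtain ⟨a, rfl⟩ := a
  obtain ⟨a', rfl⟩ := a'
  obtain rfl : a = a' := ha
  rw [Subtype.ext hb]

theorem coe_sub_congr {x y : X} {a b : E.Stalk x} {a' b' : E.Stalk y} (ha : a.1 = a'.1)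
    (hb : b.1 = b'.1) : (a - b).1 = (a' - b').1 := by
  obtain ⟨a, rfl⟩ := a
  obtain ⟨a', rfl⟩ := a'
  obtain rfl : a = a' := ha
  rw [Subtype.ext hb]

theorem coe_smul_congr (r : R) {x y : X} {a : E.Stalk x} {a' : E.Stalk y} (ha : a.1 = a'.1) :
    (r • a).1 = (r • a').1 := by
  obtain ⟨a, rfl⟩ := a
  obtain ⟨a', rfl⟩ := a'
  obtain rfl : a = a' := ha
  rfl

theorem coe_zero_congr {x y : X} (h : x = y) : (0 : E.Stalk x).1 = (0 : E.Stalk y).1 := by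
  rw [h]

variable (E) in
theorem isOpenQuotientMap_proj : IsOpenQuotientMap E.proj :=
  ⟨fun x => ⟨(0 : E.Stalk x).1, (0 : E.Stalk x).2⟩, E.isLocalHomeomorph.continuous,
    E.isLocalHomeomorph.isOpenMap⟩

/-! ### Continuity of the stalkwise operations -/

section

variable {Z : Type*} [TopologicalSpace Z] {p : Z → X} {a b : ∀ z, E.Stalk (p z)}

theorem continuous_stalk_sub (ha : Continuous fun z => (a z).1)
    (hb : Continuous fun z => (b z).1) : Continuous fun z => (a z - b z).1 := by
  have h := E.continuous_sub.comp ((ha.prodMk hb).subtype_mk fun z => by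
    rw [(a z).2, (b z).2])
  refine h.congr fun z => ?_
  exact coe_sub_congr rfl rfl

variable (E) in
-- Since `proj` is an open quotient map, it suffices that `e ↦ e - e` is continuous.
theorem continuous_zero : Continuous fun x => (0 : E.Stalk x).1 := by
  rw [← E.isOpenQuotientMap_proj.continuous_comp_iff]
  have h := continuous_stalk_sub (E := E) (p := E.proj) (a := fun e => ⟨e, rfl⟩)
    (b := fun e => ⟨e, rfl⟩) continuous_id continuous_id
  refine h.congr fun e => ?_
  simp only [sub_self, Function.comp_apply]

theorem continuous_stalk_zero (hp : Continuous p) :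
    Continuous fun z => (0 : E.Stalk (p z)).1 :=
  E.continuous_zero.comp hp

theorem continuous_stalk_neg (ha : Continuous fun z => (a z).1) :
    Continuous fun z => (-a z).1 := by
  have hp : Continuous p :=
    (E.isLocalHomeomorph.continuous.comp ha).congr fun z => (a z).2
  simpa only [zero_sub] using continuous_stalk_sub (continuous_stalk_zero (E := E) hp) ha

theorem continuous_stalk_add (ha : Continuous fun z => (a z).1)
    (hb : Continuous fun z => (b z).1) : Continuous fun z => (a z + b z).1 := by
  simpa only [sub_neg_eq_add] using continuous_stalk_sub ha (continuous_stalk_neg hb)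

theorem continuous_stalk_smul (r : R) (ha : Continuous fun z => (a z).1) :
    Continuous fun z => (r • a z).1 :=
  ((E.continuous_const_smul r).comp ha).congr fun _ => coe_smul_congr r rfl

end

theorem smul_coe_add (g : G) {x y : X} (a b : E.Stalk x) (a' b' : E.Stalk y)
    (ha : a'.1 = g • a.1) (hb : b'.1 = g • b.1) : (a' + b').1 = g • (a + b).1 := by
  rw [E.smul_stalk_add]
  exact coe_add_congr ha hb

theorem smul_coe_smul (g : G) (r : R) {x y : X} (a : E.Stalk x) (a' : E.Stalk y)
    (ha : a'.1 = g • a.1) : (r • a').1 = g • (r • a).1 := by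
  rw [E.smul_stalk_smul]
  exact coe_smul_congr r ha

theorem smul_coe_zero (g : G) {x y : X} (h : y = g • x) :
    (0 : E.Stalk y).1 = g • (0 : E.Stalk x).1 := by
  subst h
  have h0 := smul_coe_smul (E := E) g (0 : R) (0 : E.Stalk x)
    ⟨g • (0 : E.Stalk x).1, by rw [E.proj_smul, (0 : E.Stalk x).2]⟩ rfl
  rwa [zero_smul, zero_smul] at h0

variable (E) in
/-- The module of equivariant sections of `E` over `Y`. -/
def sections (Y : EtaleGSpace G X) : Submodule R (∀ y, E.Stalk (Y.proj y)) where
  carrier := {v | Continuous (fun y => (v y).1) ∧ ∀ (g : G) y, (v (g • y)).1 = g • (v y).1}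
  add_mem' hv hw := ⟨continuous_stalk_add hv.1 hw.1, fun g y =>
    smul_coe_add g _ _ _ _ (hv.2 g y) (hw.2 g y)⟩
  zero_mem' := ⟨continuous_stalk_zero Y.isLocalHomeomorph.continuous, fun g y =>
    smul_coe_zero g (Y.proj_smul g y)⟩
  smul_mem' r _ hv := ⟨continuous_stalk_smul r hv.1, fun g y =>
    smul_coe_smul g r _ _ (hv.2 g y)⟩

/-- An equivariant map over `X` into `E`, as a section. -/
def sectionOfHom {Y : EtaleGSpace G X} (f : EtaleGSpace.Hom Y E.toEtale) : E.sections Y :=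
  ⟨fun y => ⟨f.toFun y, f.proj_toFun y⟩, f.continuous_toFun, f.smul_toFun⟩

/-- A section, as an equivariant map over `X`. -/
def homOfSection {Y : EtaleGSpace G X} (v : E.sections Y) : EtaleGSpace.Hom Y E.toEtale :=
  ⟨fun y => (v.1 y).1, v.2.1, fun y => (v.1 y).2, v.2.2⟩

theorem sections_ext {Y : EtaleGSpace G X} {v w : E.sections Y}
    (h : ∀ y, (v.1 y).1 = (w.1 y).1) : v = w :=
  Subtype.ext (funext fun y => Subtype.ext (h y))

variable (E) in
/-- Restriction of sections. -/
def sectionsRestrict {Y Y' : EtaleGSpace G X} (f : EtaleGSpace.Hom Y Y') :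
    E.sections Y' →ₗ[R] E.sections Y where
  toFun v := sectionOfHom (f.comp (homOfSection v))
  map_add' v w := sections_ext fun y =>
    (coe_add_congr rfl rfl : (v.1 (f.toFun y) + w.1 (f.toFun y)).1 =
      ((⟨(v.1 (f.toFun y)).1, (v.1 (f.toFun y)).2.trans (f.proj_toFun y)⟩ : E.Stalk (Y.proj y)) +
        ⟨(w.1 (f.toFun y)).1, (w.1 (f.toFun y)).2.trans (f.proj_toFun y)⟩).1)
  map_smul' r v := sections_ext fun y =>
    (coe_smul_congr r rfl : (r • v.1 (f.toFun y)).1 =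
      (r • (⟨(v.1 (f.toFun y)).1, (v.1 (f.toFun y)).2.trans (f.proj_toFun y)⟩ :
        E.Stalk (Y.proj y))).1)

variable {F}

/-- A map of `G`-sheaves induces a map on sections. -/
def sectionsMap (f : E ⟶ F) (Y : EtaleGSpace G X) : E.sections Y →ₗ[R] F.sections Y where
  toFun v := ⟨fun y => Hom.stalkMap f _ (v.1 y), (Hom.continuous_toFun f).comp v.2.1, fun g y => by
    change Hom.toFun f _ = g • Hom.toFun f _
    rw [v.2.2, Hom.smul_toFun f]⟩
  map_add' _ _ := Subtype.ext (funext fun _ => map_add _ _ _)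
  map_smul' _ _ := Subtype.ext (funext fun _ => map_smul _ _ _)

/-! ### Addition of maps -/

theorem hom_ext_stalkMap {f g : E ⟶ F}
    (h : ∀ x, Hom.stalkMap f x = Hom.stalkMap g x) : f = g :=
  Hom.ext (funext fun e => congrArg Subtype.val
    (LinearMap.congr_fun (h (E.proj e)) (⟨e, rfl⟩ : E.Stalk (E.proj e))))

theorem hom_ext_toFun {f g : E ⟶ F} (h : ∀ e, Hom.toFun f e = Hom.toFun g e) : f = g :=
  Hom.ext (funext h)

variable (E F) in
/-- The families of linear maps of stalks which define a map of `G`-sheaves. -/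
def stalkFamilies : AddSubgroup (∀ x, E.Stalk x →ₗ[R] F.Stalk x) where
  carrier := {φ | Continuous (fun e => (φ (E.proj e) ⟨e, rfl⟩).1) ∧
    ∀ (g : G) (e : E.carrier), (φ (E.proj (g • e)) ⟨g • e, rfl⟩).1 = g • (φ (E.proj e) ⟨e, rfl⟩).1}
  add_mem' hφ hψ := ⟨continuous_stalk_add hφ.1 hψ.1, fun g e =>
    smul_coe_add g _ _ _ _ (hφ.2 g e) (hψ.2 g e)⟩
  zero_mem' := ⟨continuous_stalk_zero E.isLocalHomeomorph.continuous, fun g e =>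
    smul_coe_zero g (E.proj_smul g e)⟩
  neg_mem' {φ} hφ := ⟨continuous_stalk_neg hφ.1, fun g e => by
    -- Negation is multiplication by `-1`, so its equivariance follows from that of scalars.
    have h := smul_coe_smul (E := F) g (-1 : R) _ _ (hφ.2 g e)
    simp only [neg_smul, one_smul] at h
    exact h⟩

theorem apply_proj_coe (φ : ∀ x, E.Stalk x →ₗ[R] F.Stalk x) {x : X} (a : E.Stalk x) :
    (φ (E.proj a.1) ⟨a.1, rfl⟩).1 = (φ x a).1 := by
  obtain ⟨a, rfl⟩ := a
  rfl

variable (E F) in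
/-- Maps of `G`-sheaves are families of linear maps of stalks. -/
def homEquiv : (E ⟶ F) ≃ E.stalkFamilies F where
  toFun f := ⟨fun x => Hom.stalkMap f x, Hom.continuous_toFun f, fun g e => Hom.smul_toFun f g e⟩
  invFun φ := show E.Hom F from
    { toFun := fun e => (φ.1 (E.proj e) ⟨e, rfl⟩).1
      continuous_toFun := φ.2.1
      proj_toFun := fun e => (φ.1 (E.proj e) ⟨e, rfl⟩).2
      smul_toFun := φ.2.2
      add_toFun := fun x a b => by
        rw [apply_proj_coe, map_add]
        exact coe_add_congr (apply_proj_coe φ.1 a).symm (apply_proj_coe φ.1 b).symm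
      const_smul_toFun := fun x r a => by
        rw [apply_proj_coe, map_smul]
        exact coe_smul_congr r (apply_proj_coe φ.1 a).symm }
  left_inv _ := rfl
  right_inv φ := Subtype.ext (funext fun x => LinearMap.ext fun a =>
    Subtype.ext (apply_proj_coe φ.1 a))

/-- Addition of maps of `G`-sheaves. -/
abbrev homAddCommGroup : AddCommGroup (E ⟶ F) := (homEquiv E F).addCommGroup

attribute [local instance] homAddCommGroup

theorem stalkMap_add (f g : E ⟶ F) (x : X) :
    Hom.stalkMap (f + g) x = Hom.stalkMap f x + Hom.stalkMap g x := by
  change ((homEquiv E F) ((homEquiv E F).symm (homEquiv E F f + homEquiv E F g))).1 x = _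
  rw [Equiv.apply_symm_apply]
  rfl

theorem stalkMap_zero (x : X) : Hom.stalkMap (0 : E ⟶ F) x = 0 := by
  change ((homEquiv E F) ((homEquiv E F).symm 0)).1 x = _
  rw [Equiv.apply_symm_apply]
  rfl

theorem stalkMap_comp {H : GSheaf G R X} (f : E ⟶ F) (g : F ⟶ H) (x : X) :
    Hom.stalkMap (f ≫ g) x = (Hom.stalkMap g x).comp (Hom.stalkMap f x) := rfl

/-- The category of `G`-sheaves is preadditive, with stalkwise addition of maps. -/
abbrev preadditive : Preadditive (GSheaf G R X) where
  homGroup _ _ := homAddCommGroup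
  add_comp _ _ _ f f' g := hom_ext_stalkMap fun x => by
    simp only [stalkMap_comp, stalkMap_add, LinearMap.comp_add]
  comp_add _ _ _ f g g' := hom_ext_stalkMap fun x => by
    simp only [stalkMap_comp, stalkMap_add, LinearMap.add_comp]

attribute [local instance] preadditive

theorem zero_toFun (e : E.carrier) :
    Hom.toFun (0 : E ⟶ F) e = (0 : F.Stalk (E.proj e)).1 :=
  congrArg Subtype.val (LinearMap.congr_fun (stalkMap_zero (E.proj e)) ⟨e, rfl⟩)

/-- A bijective map of `G`-sheaves is an isomorphism. -/
theorem isIso_of_bijective (f : E ⟶ F) (hf : Function.Bijective (Hom.toFun f)) : IsIso f := by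
  have hloc : IsLocalHomeomorph (Hom.toFun f) :=
    EtaleGSpace.Hom.isLocalHomeomorph (Y := E.toEtale) (Z := F.toEtale)
      ⟨Hom.toFun f, Hom.continuous_toFun f, Hom.proj_toFun f, Hom.smul_toFun f⟩
  let h := Equiv.ofBijective _ hf
  have hp : ∀ e, E.proj (h.symm e) = F.proj e := fun e => by
    rw [← Hom.proj_toFun f]
    exact congrArg F.proj (h.apply_symm_apply e)
  refine ⟨show F.Hom E from
    { toFun := h.symm
      continuous_toFun :=
        (h.toHomeomorphOfContinuousOpen hloc.continuous hloc.isOpenMap).symm.continuous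
      proj_toFun := hp
      smul_toFun := fun g e => h.injective ?_
      add_toFun := fun x a b => h.injective ?_
      const_smul_toFun := fun x r a => h.injective ?_ }, ?_, ?_⟩
  · rw [h.apply_symm_apply]
    exact ((Hom.smul_toFun f g _).trans (congrArg (g • ·) (h.apply_symm_apply e))).symm
  · rw [h.apply_symm_apply]
    refine (Eq.trans (Hom.add_toFun f x _ _) ?_).symm
    exact coe_add_congr (h.apply_symm_apply _) (h.apply_symm_apply _)
  · rw [h.apply_symm_apply]
    refine (Eq.trans (Hom.const_smul_toFun f x r _) ?_).symm
    exact coe_smul_congr r (h.apply_symm_apply _)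
  · exact hom_ext_toFun fun e => h.symm_apply_apply e
  · exact hom_ext_toFun fun e => h.apply_symm_apply e

/-- A map of `G`-sheaves whose values lie in the image of an injective one factors through it. -/
theorem exists_lift {H : GSheaf G R X} (i : E ⟶ F) (hi : Function.Injective (Hom.toFun i))
    (f : H ⟶ F) (hf : ∀ e, ∃ e', Hom.toFun i e' = Hom.toFun f e) : ∃ l : H ⟶ E, l ≫ i = f := by
  have hloc : IsLocalHomeomorph (Hom.toFun i) :=
    EtaleGSpace.Hom.isLocalHomeomorph (Y := E.toEtale) (Z := F.toEtale)
      ⟨Hom.toFun i, Hom.continuous_toFun i, Hom.proj_toFun i, Hom.smul_toFun i⟩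
  choose l hl using hf
  have hp : ∀ e, E.proj (l e) = H.proj e := fun e => by
    rw [← Hom.proj_toFun i, hl, Hom.proj_toFun f]
  refine ⟨show H.Hom E from
    { toFun := l
      -- An injective local homeomorphism is an open embedding, so continuity can be read off after
      -- composing with `i`.
      continuous_toFun := (hloc.isOpenEmbedding_of_injective hi).isInducing.continuous_iff.2
        ((Hom.continuous_toFun f).congr fun e => (hl e).symm)
      proj_toFun := hp
      smul_toFun := fun g e => hi ?_
      add_toFun := fun x a b => hi ?_
      const_smul_toFun := fun x r a => hi ?_ }, hom_ext_toFun hl⟩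
  · rw [hl, Hom.smul_toFun i, hl, Hom.smul_toFun f]
  · rw [hl, Hom.add_toFun f]
    exact (Eq.trans (Hom.add_toFun i x _ _) (coe_add_congr (hl _) (hl _))).symm
  · rw [hl, Hom.const_smul_toFun f]
    exact (Eq.trans (Hom.const_smul_toFun i x r _) (coe_smul_congr r (hl _))).symm

end

end GSheaf

/-! ### The `G`-sheaf associated with a presheaf on charts -/

open Opposite

section

variable {G R X : Type u} [Group G] [TopologicalSpace G] [IsTopologicalGroup G] [Ring R]
  [TopologicalSpace X] [MulAction G X] [ContinuousSMul G X] {S : X → Set G} [HasCharts S]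

/-- A point of a chart together with an element of `P` on this chart. -/
abbrev GermRep (P : (Chart S)ᵒᵖ ⥤ ModuleCat.{u} R) : Type u :=
  Σ i : (Σ c : Chart S, P.obj (op c)), i.1.Pt

/-- Two representatives define the same germ if they agree on a common refinement. -/
def germSetoid (P : (Chart S)ᵒᵖ ⥤ ModuleCat.{u} R) : Setoid (GermRep P) where
  r z w := ∃ (e : Chart S) (t : e.Pt) (f : e ⟶ z.1.1) (g : e ⟶ w.1.1),
    Chart.app f t = z.2 ∧ Chart.app g t = w.2 ∧ P.map f.op z.1.2 = P.map g.op w.1.2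
  iseqv :=
    { refl := fun z => ⟨z.1.1, z.2, 𝟙 _, 𝟙 _, rfl, rfl, rfl⟩
      symm := fun ⟨e, t, f, g, hf, hg, h⟩ => ⟨e, t, g, f, hg, hf, h.symm⟩
      trans := by
        rintro x y z ⟨e, t, f, g, hf, hg, h⟩ ⟨e', t', f', g', hf', hg', h'⟩
        -- The two refinements are refined together over the middle chart.
        obtain ⟨k, w, a, b, ha, hb, hab⟩ :=
          Chart.exists_pullback_hom g f' t t' (hg.trans hf'.symm)
        refine ⟨k, w, a ≫ f, b ≫ g', ?_, ?_, ?_⟩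
        · exact (congrArg (Chart.app f) ha).trans hf
        · exact (congrArg (Chart.app g') hb).trans hg'
        · rw [op_comp, op_comp, P.map_comp, P.map_comp, ModuleCat.comp_apply, ModuleCat.comp_apply,
            h, ← h', ← ModuleCat.comp_apply, ← ModuleCat.comp_apply, ← P.map_comp, ← P.map_comp,
            ← op_comp, ← op_comp, hab] }

/-- The sheaf space of a presheaf on charts. -/
def Germ (P : (Chart S)ᵒᵖ ⥤ ModuleCat.{u} R) : Type u := Quotient (germSetoid P)

namespace Germ

variable {P Q : (Chart S)ᵒᵖ ⥤ ModuleCat.{u} R}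

/-- The germ of `s` at the point `t`. -/
def mk {c : Chart S} (s : P.obj (op c)) (t : c.Pt) : Germ P :=
  Quotient.mk (germSetoid P) ⟨⟨c, s⟩, t⟩

theorem exists_rep (a : Germ P) : ∃ (c : Chart S) (s : P.obj (op c)) (t : c.Pt), mk s t = a := by
  obtain ⟨⟨⟨c, s⟩, t⟩, rfl⟩ := Quotient.exists_rep a
  exact ⟨c, s, t, rfl⟩

theorem mk_map {c d : Chart S} (f : c ⟶ d) (s : P.obj (op d)) (t : c.Pt) :
    mk (P.map f.op s) t = mk s (Chart.app f t) :=
  Quotient.sound (s := germSetoid P) ⟨c, t, 𝟙 c, f, rfl, rfl, by simp⟩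

theorem mk_eq_mk {c d : Chart S} {s : P.obj (op c)} {t : c.Pt} {s' : P.obj (op d)} {t' : d.Pt} :
    mk s t = mk s' t' ↔ ∃ (e : Chart S) (w : e.Pt) (f : e ⟶ c) (g : e ⟶ d),
      Chart.app f w = t ∧ Chart.app g w = t' ∧ P.map f.op s = P.map g.op s' :=
  Quotient.eq (r := germSetoid P)

/-- The two refining maps agree at the point, so a further refinement equalises them. -/
theorem mk_eq_mk_iff {c : Chart S} {s s' : P.obj (op c)} {t : c.Pt} :
    mk s t = mk s' t ↔ ∃ (e : Chart S) (w : e.Pt) (f : e ⟶ c),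
      Chart.app f w = t ∧ P.map f.op s = P.map f.op s' := by
  rw [mk_eq_mk]
  constructor
  · rintro ⟨e, w, f, g, hf, hg, h⟩
    obtain ⟨k, z, a, ha, hag⟩ := Chart.exists_equalizer f g w (hf.trans hg.symm)
    refine ⟨k, z, a ≫ f, (congrArg (Chart.app f) ha).trans hf, ?_⟩
    conv_rhs => rw [hag]
    rw [op_comp, op_comp, P.map_comp, P.map_comp, ModuleCat.comp_apply, ModuleCat.comp_apply, h]
  · rintro ⟨e, w, f, hf, h⟩
    exact ⟨e, w, f, f, hf, hf, h⟩

/-- The projection to the base. -/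
def proj : Germ P → X :=
  Quotient.lift (fun z : GermRep P => z.1.1.space.proj z.2) (by
    rintro ⟨⟨c, s⟩, t⟩ ⟨⟨d, s'⟩, t'⟩ ⟨e, w, f, g, hf, hg, h⟩
    dsimp only at f g hf hg ⊢
    rw [← hf, ← hg, EtaleGSpace.Hom.proj_toFun f, EtaleGSpace.Hom.proj_toFun g])

theorem exists_rep₂ (a b : Germ P) (h : proj a = proj b) :
    ∃ (c : Chart S) (t : c.Pt) (s s' : P.obj (op c)), a = mk s t ∧ b = mk s' t := by
  obtain ⟨c, s, t, rfl⟩ := exists_rep a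
  obtain ⟨d, s', t', rfl⟩ := exists_rep b
  obtain ⟨e, w, f, g, rfl, rfl⟩ := Chart.exists_prod t t' h
  exact ⟨e, w, P.map f.op s, P.map g.op s', (mk_map f s w).symm, (mk_map g s' w).symm⟩

theorem exists_rep₃ (a b a' : Germ P) (h : proj a = proj b) (h' : proj a = proj a') :
    ∃ (c : Chart S) (t : c.Pt) (s s' s'' : P.obj (op c)),
      a = mk s t ∧ b = mk s' t ∧ a' = mk s'' t := by
  obtain ⟨c, t, s, s', rfl, rfl⟩ := exists_rep₂ a b h
  obtain ⟨d, s'', t', rfl⟩ := exists_rep a'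
  obtain ⟨e, w, f, g, rfl, rfl⟩ := Chart.exists_prod t t' h'
  exact ⟨e, w, P.map f.op s, P.map f.op s', P.map g.op s'', (mk_map f s w).symm,
    (mk_map f s' w).symm, (mk_map g s'' w).symm⟩

instance : MulAction G (Germ P) where
  smul g := Quotient.map (fun z : GermRep P => ⟨z.1, g • z.2⟩) (by
    rintro ⟨⟨c, s⟩, t⟩ ⟨⟨d, s'⟩, t'⟩ ⟨e, w, f, f', hf, hf', h⟩
    refine ⟨e, g • w, f, f', ?_, ?_, h⟩
    · exact (EtaleGSpace.Hom.smul_toFun f g w).trans (congrArg (g • ·) hf)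
    · exact (EtaleGSpace.Hom.smul_toFun f' g w).trans (congrArg (g • ·) hf'))
  one_smul a := by
    obtain ⟨c, s, t, rfl⟩ := exists_rep a
    exact congrArg (mk s) (one_smul G t)
  mul_smul g h a := by
    obtain ⟨c, s, t, rfl⟩ := exists_rep a
    exact congrArg (mk s) (mul_smul g h t)

instance : TopologicalSpace (Germ P) :=
  TopologicalSpace.coinduced (fun z : GermRep P => mk z.1.2 z.2) inferInstance

variable (P) in
-- The saturation of an open set is a union of sets `g(f⁻¹(W))` with `f`, `g` maps of charts, and
-- maps of charts are open. Openness lets the quotient survive products with `G` and lets local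
-- homeomorphisms descend.
theorem isOpenQuotientMap_mk : IsOpenQuotientMap fun z : GermRep P => mk z.1.2 z.2 := by
  refine ⟨fun a => ?_, continuous_coinduced_rng, ?_⟩
  · obtain ⟨c, s, t, rfl⟩ := exists_rep a
    exact ⟨⟨⟨c, s⟩, t⟩, rfl⟩
  intro V hV
  refine isOpen_coinduced.2 (isOpen_sigma_iff.2 ?_)
  rintro ⟨d, s'⟩
  rw [isOpen_iff_forall_mem_open]
  rintro t' ⟨⟨⟨c, s⟩, t⟩, ht, htt'⟩
  change mk s t = mk s' t' at htt'
  change c.Pt at t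
  change d.Pt at t'
  obtain ⟨e, w, f, g, rfl, rfl, h⟩ := mk_eq_mk.1 htt'
  let W : Set c.Pt := {t | (⟨⟨c, s⟩, t⟩ : GermRep P) ∈ V}
  have hW : IsOpen W := isOpen_sigma_iff.1 hV ⟨c, s⟩
  refine ⟨Chart.app g '' (Chart.app f ⁻¹' W), ?_, ?_, ⟨w, ht, rfl⟩⟩
  · rintro _ ⟨z, hz, rfl⟩
    refine ⟨⟨⟨c, s⟩, Chart.app f z⟩, hz, ?_⟩
    exact mk_eq_mk.2 ⟨e, z, f, g, rfl, rfl, h⟩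
  · refine (EtaleGSpace.Hom.isLocalHomeomorph g).isOpenMap _ ?_
    exact hW.preimage (EtaleGSpace.Hom.continuous_toFun f)

theorem continuous_mk {c : Chart S} (s : P.obj (op c)) : Continuous fun t : c.Pt => mk s t :=
  (isOpenQuotientMap_mk P).continuous.comp (continuous_sigmaMk (σ := fun i :
    (Σ c : Chart S, P.obj (op c)) => i.1.Pt) (i := ⟨c, s⟩))

instance : ContinuousSMul G (Germ P) where
  continuous_smul := by
    -- The product with `G` is again an open quotient map, so continuity is checked on each chart
    -- separately.
    have hq := (IsOpenQuotientMap.id (X := G)).prodMap (isOpenQuotientMap_mk P)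
    rw [← hq.continuous_comp_iff, ← (Homeomorph.prodComm _ _).comp_continuous_iff',
      ← (Homeomorph.sigmaProdDistrib).symm.comp_continuous_iff']
    refine continuous_sigma fun i => ?_
    exact (continuous_mk i.2).comp (continuous_snd.smul continuous_fst)

variable (P) in
theorem isLocalHomeomorph_proj : IsLocalHomeomorph (proj : Germ P → X) :=
  IsLocalHomeomorph.of_comp_isOpenQuotientMap (isOpenQuotientMap_mk P)
    (IsLocalHomeomorph.sigma fun i : (Σ c : Chart S, P.obj (op c)) =>
      i.1.space.isLocalHomeomorph)

theorem proj_smul (g : G) (a : Germ P) : proj (g • a) = g • proj a := by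
  obtain ⟨c, s, t, rfl⟩ := exists_rep a
  exact c.space.proj_smul g t

variable (P) in
/-- The étale space of germs. -/
def etale : EtaleGSpace G X where
  carrier := Germ P
  proj := proj
  isLocalHomeomorph := isLocalHomeomorph_proj P
  proj_smul := proj_smul

/-- The map to the étale space of germs defined by an element of `P` on a chart. -/
def mkHom {c : Chart S} (s : P.obj (op c)) : EtaleGSpace.Hom c.space (etale P) where
  toFun := mk s
  continuous_toFun := continuous_mk s
  proj_toFun _ := rfl
  smul_toFun _ _ := rfl

/-! #### The module structure on stalks -/

/-- After passing to one chart, the equalities for the two summands hold on two different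
refinements; a chart refining both carries their sum. -/
theorem mk_add_congr {c d : Chart S} {s s' : P.obj (op c)} {r r' : P.obj (op d)} {t : c.Pt}
    {t' : d.Pt} (h : mk s t = mk r t') (h' : mk s' t = mk r' t') :
    mk (s + s') t = mk (r + r') t' := by
  obtain ⟨e, w, f, g, rfl, rfl⟩ := Chart.exists_prod t t' (congrArg proj h)
  rw [← mk_map, ← mk_map] at h h' ⊢
  rw [map_add, map_add]
  obtain ⟨k, z, a, rfl, ha⟩ := mk_eq_mk_iff.1 h
  obtain ⟨k', z', a', hz, ha'⟩ := mk_eq_mk_iff.1 h'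
  obtain ⟨l, v, b, b', rfl, rfl, hb⟩ := Chart.exists_pullback_hom a a' z z' hz.symm
  refine mk_eq_mk_iff.2 ⟨l, v, b ≫ a, rfl, ?_⟩
  rw [map_add, map_add]
  congr 1
  · rw [op_comp, P.map_comp, ModuleCat.comp_apply, ModuleCat.comp_apply, ha]
  · rw [hb, op_comp, P.map_comp, ModuleCat.comp_apply, ModuleCat.comp_apply, ha']

theorem mk_smul_congr (x : R) {c d : Chart S} {s : P.obj (op c)} {r : P.obj (op d)} {t : c.Pt}
    {t' : d.Pt} (h : mk s t = mk r t') : mk (x • s) t = mk (x • r) t' := by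
  obtain ⟨e, w, f, g, hf, hg, h'⟩ := mk_eq_mk.1 h
  exact mk_eq_mk.2 ⟨e, w, f, g, hf, hg, by rw [map_smul, map_smul, h']⟩

variable (P) in
theorem mk_zero_congr {c d : Chart S} {t : c.Pt} {t' : d.Pt}
    (h : c.space.proj t = d.space.proj t') :
    mk (0 : P.obj (op c)) t = mk (0 : P.obj (op d)) t' := by
  obtain ⟨e, w, f, g, rfl, rfl⟩ := Chart.exists_prod t t' h
  rw [← mk_map, ← mk_map, map_zero, map_zero]

/-- The stalk of the space of germs. -/
abbrev Stalk (P : (Chart S)ᵒᵖ ⥤ ModuleCat.{u} R) (x : X) : Type u := {a : Germ P // proj a = x}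

/-- The germ of `s` at `t`, in the stalk. -/
def stalkMk {x : X} {c : Chart S} (t : c.Pt) (h : c.space.proj t = x) (s : P.obj (op c)) :
    Stalk P x := ⟨mk s t, h⟩

theorem exists_stalkMk {x : X} (a b a' : Stalk P x) :
    ∃ (c : Chart S) (t : c.Pt) (h : c.space.proj t = x) (s s' s'' : P.obj (op c)),
      a = stalkMk t h s ∧ b = stalkMk t h s' ∧ a' = stalkMk t h s'' := by
  obtain ⟨a, rfl⟩ := a
  obtain ⟨b, hb⟩ := b
  obtain ⟨a', ha'⟩ := a'
  obtain ⟨c, t, s, s', s'', rfl, rfl, rfl⟩ := exists_rep₃ a b a' hb.symm ha'.symm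
  exact ⟨c, t, rfl, s, s', s'', rfl, rfl, rfl⟩

theorem exists_stalkMk₂ {x : X} (a b : Stalk P x) :
    ∃ (c : Chart S) (t : c.Pt) (h : c.space.proj t = x) (s s' : P.obj (op c)),
      a = stalkMk t h s ∧ b = stalkMk t h s' := by
  obtain ⟨c, t, h, s, s', -, ha, hb, -⟩ := exists_stalkMk a b a
  exact ⟨c, t, h, s, s', ha, hb⟩

theorem exists_stalkMk₁ {x : X} (a : Stalk P x) :
    ∃ (c : Chart S) (t : c.Pt) (h : c.space.proj t = x) (s : P.obj (op c)), a = stalkMk t h s := by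
  obtain ⟨c, t, h, s, -, ha, -⟩ := exists_stalkMk₂ a a
  exact ⟨c, t, h, s, ha⟩

/-- Common representatives are chosen; `mk_add_congr` makes the sum independent of the choice. -/
noncomputable instance (x : X) : Add (Stalk P x) where
  add a b :=
    let h := exists_stalkMk₂ a b
    stalkMk h.choose_spec.choose h.choose_spec.choose_spec.choose
      (h.choose_spec.choose_spec.choose_spec.choose +
        h.choose_spec.choose_spec.choose_spec.choose_spec.choose)

noncomputable instance (x : X) : SMul R (Stalk P x) where
  smul r a :=
    let h := exists_stalkMk₁ a
    stalkMk h.choose_spec.choose h.choose_spec.choose_spec.choose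
      (r • h.choose_spec.choose_spec.choose_spec.choose)

noncomputable instance (x : X) : Zero (Stalk P x) where
  zero :=
    let h := Chart.exists_pt S x
    stalkMk h.choose_spec.choose h.choose_spec.choose_spec 0

theorem stalkMk_add {x : X} {c : Chart S} (t : c.Pt) (h : c.space.proj t = x)
    (s s' : P.obj (op c)) : stalkMk t h (s + s') = stalkMk t h s + stalkMk t h s' := by
  have h2 := exists_stalkMk₂ (stalkMk t h s) (stalkMk t h s')
  have h3 := h2.choose_spec.choose_spec.choose_spec.choose_spec.choose_spec
  exact Subtype.ext (mk_add_congr (congrArg Subtype.val h3.1) (congrArg Subtype.val h3.2))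

theorem stalkMk_smul {x : X} {c : Chart S} (t : c.Pt) (h : c.space.proj t = x) (r : R)
    (s : P.obj (op c)) : stalkMk t h (r • s) = r • stalkMk t h s := by
  have h2 := exists_stalkMk₁ (stalkMk t h s)
  have h3 := h2.choose_spec.choose_spec.choose_spec.choose_spec
  exact Subtype.ext (mk_smul_congr r (congrArg Subtype.val h3))

theorem stalkMk_zero {x : X} {c : Chart S} (t : c.Pt) (h : c.space.proj t = x) :
    stalkMk t h (0 : P.obj (op c)) = 0 :=
  Subtype.ext (mk_zero_congr P (h.trans (Chart.exists_pt S x).choose_spec.choose_spec.symm))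

noncomputable instance (x : X) : Neg (Stalk P x) where
  neg a := (-1 : R) • a

noncomputable instance (x : X) : AddCommGroup (Stalk P x) where
  add_assoc a b a' := by
    obtain ⟨c, t, h, s, s', s'', rfl, rfl, rfl⟩ := exists_stalkMk a b a'
    rw [← stalkMk_add, ← stalkMk_add, ← stalkMk_add, ← stalkMk_add, add_assoc]
  zero_add a := by
    obtain ⟨c, t, h, s, rfl⟩ := exists_stalkMk₁ a
    rw [← stalkMk_zero t h, ← stalkMk_add, zero_add]
  add_zero a := by
    obtain ⟨c, t, h, s, rfl⟩ := exists_stalkMk₁ a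
    rw [← stalkMk_zero t h, ← stalkMk_add, add_zero]
  add_comm a b := by
    obtain ⟨c, t, h, s, s', rfl, rfl⟩ := exists_stalkMk₂ a b
    rw [← stalkMk_add, ← stalkMk_add, add_comm]
  nsmul := nsmulRec
  zsmul := zsmulRec
  neg_add_cancel a := by
    obtain ⟨c, t, h, s, rfl⟩ := exists_stalkMk₁ a
    change (-1 : R) • stalkMk t h s + stalkMk t h s = 0
    rw [← stalkMk_smul, ← stalkMk_add, neg_smul, one_smul, neg_add_cancel, stalkMk_zero]

noncomputable instance (x : X) : Module R (Stalk P x) where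
  one_smul a := by
    obtain ⟨c, t, h, s, rfl⟩ := exists_stalkMk₁ a
    rw [← stalkMk_smul, one_smul]
  mul_smul r r' a := by
    obtain ⟨c, t, h, s, rfl⟩ := exists_stalkMk₁ a
    rw [← stalkMk_smul, ← stalkMk_smul, ← stalkMk_smul, mul_smul]
  smul_zero r := by
    obtain ⟨c, t, h⟩ := Chart.exists_pt S x
    rw [← stalkMk_zero t h, ← stalkMk_smul, smul_zero]
  smul_add r a b := by
    obtain ⟨c, t, h, s, s', rfl, rfl⟩ := exists_stalkMk₂ a b
    rw [← stalkMk_add, ← stalkMk_smul, ← stalkMk_smul, ← stalkMk_smul, ← stalkMk_add, smul_add]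
  add_smul r r' a := by
    obtain ⟨c, t, h, s, rfl⟩ := exists_stalkMk₁ a
    rw [← stalkMk_smul, ← stalkMk_smul, ← stalkMk_smul, ← stalkMk_add, add_smul]
  zero_smul a := by
    obtain ⟨c, t, h, s, rfl⟩ := exists_stalkMk₁ a
    rw [← stalkMk_smul, zero_smul, stalkMk_zero]

variable (P) in
/-- Taking germs, as a linear map to the stalk. -/
noncomputable def stalkMkₗ {x : X} {c : Chart S} (t : c.Pt) (h : c.space.proj t = x) :
    P.obj (op c) →ₗ[R] Stalk P x where
  toFun := stalkMk t h
  map_add' := stalkMk_add t h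
  map_smul' := stalkMk_smul t h

variable (P) in
/-- The `G`-sheaf associated with `P`. -/
noncomputable def sheaf : GSheaf G R X where
  carrier := Germ P
  proj := proj
  isLocalHomeomorph := isLocalHomeomorph_proj P
  proj_smul := proj_smul
  continuous_sub := by
    rw [continuous_iff_continuousAt]
    rintro ⟨⟨a, b⟩, hab⟩
    obtain ⟨c, t, s, s', rfl, rfl⟩ := exists_rep₂ a b hab
    -- The pair of germs of `s` and `s'` is a map of étale spaces, hence a local homeomorphism;
    -- along it, subtraction is the germ of `s - s'`.
    let σ := EtaleGSpace.pullbackLift (f := (etale P).toBase) (g := (etale P).toBase)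
      (mkHom s) (mkHom s') (fun _ => rfl)
    refine σ.isLocalHomeomorph.continuousAt_of_comp ?_ t
    refine (continuous_mk (s - s')).congr fun t' => ?_
    exact congrArg Subtype.val (map_sub (stalkMkₗ P t' rfl) s s')
  continuous_const_smul r := by
    rw [continuous_iff_continuousAt]
    intro a
    obtain ⟨c, s, t, rfl⟩ := exists_rep a
    refine (mkHom s).isLocalHomeomorph.continuousAt_of_comp ?_ t
    refine (continuous_mk (r • s)).congr fun t' => ?_
    exact congrArg Subtype.val (map_smul (stalkMkₗ P t' rfl) r s)
  smul_stalk_add g x a b := by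
    obtain ⟨c, t, h, s, s', rfl, rfl⟩ := exists_stalkMk₂ a b
    rw [← stalkMk_add]
    have hg : c.space.proj (g • t) = g • x := by rw [c.space.proj_smul, h]
    exact congrArg Subtype.val (stalkMk_add (g • t) hg s s')
  smul_stalk_smul g x r a := by
    obtain ⟨c, t, h, s, rfl⟩ := exists_stalkMk₁ a
    rw [← stalkMk_smul]
    have hg : c.space.proj (g • t) = g • x := by rw [c.space.proj_smul, h]
    exact congrArg Subtype.val (stalkMk_smul (g • t) hg r s)

end Germ

end

/-! ### Sheaves with prescribed fixed points as a reflective subcategory of presheaves -/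

section

variable {G X : Type u} [Group G] [TopologicalSpace G] [TopologicalSpace X] [MulAction G X]

/-- The `G`-sheaves on whose stalks over `x` the elements of `S x` act trivially. -/
def GSheaf.IsFixedBy {R : Type u} [Ring R] (S : X → Set G) : ObjectProperty (GSheaf G R X) :=
  fun E => ∀ (x : X) (e : E.Stalk x), ∀ k ∈ S x, k • e.1 = e.1

theorem GSheaf.IsFixedBy.toEtale {R : Type u} [Ring R] {S : X → Set G} {E : GSheaf G R X}
    (hE : E.IsFixedBy S) : E.toEtale.FixedBy S := fun e k hk => hE _ ⟨e, rfl⟩ k hk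

/-- The category of `G`-sheaves on whose stalks over `x` the elements of `S x` act trivially. -/
abbrev FixedSheaf (R : Type u) [Ring R] (S : X → Set G) : Type (u + 1) :=
  (GSheaf.IsFixedBy S : ObjectProperty (GSheaf G R X)).FullSubcategory

namespace FixedSheaf

theorem mono_of_injective {R : Type u} [Ring R] {S : X → Set G} {E F : FixedSheaf R S} (f : E ⟶ F)
    (hf : Function.Injective (GSheaf.Hom.toFun f.hom)) : Mono f where
  right_cancellation _ _ hgh := ObjectProperty.hom_ext _ (GSheaf.hom_ext_toFun fun e => hf
    (congrArg (fun k => GSheaf.Hom.toFun k.hom e) hgh))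

variable (R : Type u) [Ring R] (S : X → Set G) [IsTopologicalGroup G] [ContinuousSMul G X]

/-- The presheaf of sections over charts. -/
def sections : FixedSheaf R S ⥤ (Chart S)ᵒᵖ ⥤ ModuleCat.{u} R where
  obj E :=
    { obj := fun c => ModuleCat.of R (E.obj.sections c.unop.space)
      map := fun f => ModuleCat.ofHom (E.obj.sectionsRestrict f.unop) }
  map f := { app := fun c => ModuleCat.ofHom (GSheaf.sectionsMap f.hom c.unop.space) }

section

variable {R S} {P : (Chart S)ᵒᵖ ⥤ ModuleCat.{u} R} {E : FixedSheaf R S}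

/-- The section defined by an element of `P` on a chart. -/
def sectionOf (ψ : P ⟶ (sections R S).obj E) {c : Chart S} (s : P.obj (op c)) :
    E.obj.sections c.space := ψ.app (op c) s

theorem sectionOf_map (ψ : P ⟶ (sections R S).obj E) {c d : Chart S} (f : c ⟶ d)
    (s : P.obj (op d)) (t : c.Pt) :
    ((sectionOf ψ (P.map f.op s)).1 t).1 = ((sectionOf ψ s).1 (Chart.app f t)).1 :=
  congrArg (fun v : E.obj.sections c.space => (v.1 t).1)
    (ConcreteCategory.congr_hom (ψ.naturality f.op) s)

theorem sectionOf_add (ψ : P ⟶ (sections R S).obj E) {c : Chart S} (s s' : P.obj (op c)) :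
    sectionOf ψ (s + s') = sectionOf ψ s + sectionOf ψ s' := map_add (ψ.app (op c)).hom s s'

theorem sectionOf_smul (ψ : P ⟶ (sections R S).obj E) {c : Chart S} (r : R) (s : P.obj (op c)) :
    sectionOf ψ (r • s) = r • sectionOf ψ s := map_smul (ψ.app (op c)).hom r s

end

variable {R S} [HasCharts S] {P Q : (Chart S)ᵒᵖ ⥤ ModuleCat.{u} R} {E : FixedSheaf R S}


variable (P) in
/-- The sheaf associated with a presheaf on charts. -/
noncomputable def ofPresheaf : FixedSheaf R S where
  obj := Germ.sheaf P
  property := by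
    rintro x ⟨a, rfl⟩ k hk
    obtain ⟨c, s, t, rfl⟩ := Germ.exists_rep a
    exact congrArg (Germ.mk s) (c.fixedBy_space t k hk)

variable (P) in
/-- The map from a presheaf to the sections of the associated sheaf. -/
noncomputable def toSections : P ⟶ (sections R S).obj (ofPresheaf P) where
  app c := ModuleCat.ofHom
    { toFun := fun s => GSheaf.sectionOfHom (E := Germ.sheaf P) (Germ.mkHom s)
      map_add' := fun s s' => GSheaf.sections_ext fun t =>
        congrArg Subtype.val (Germ.stalkMk_add t rfl s s')
      map_smul' := fun r s => GSheaf.sections_ext fun t =>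
        congrArg Subtype.val (Germ.stalkMk_smul t rfl r s) }
  naturality c d f := by
    ext s
    exact GSheaf.sections_ext fun t => Germ.mk_map f.unop s t

/-- The map on germs induced by a map to the presheaf of sections. -/
def descFun (ψ : P ⟶ (sections R S).obj E) : Germ P → E.obj.carrier :=
  Quotient.lift (fun z : GermRep P => ((sectionOf ψ z.1.2).1 z.2).1) (by
    rintro ⟨⟨c, s⟩, t⟩ ⟨⟨d, s'⟩, t'⟩ ⟨e, w, f, g, hf, hg, h⟩
    dsimp only at f g hf hg h ⊢
    rw [← hf, ← hg, ← sectionOf_map, ← sectionOf_map, h])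

/-- The map from the associated sheaf induced by a map to the presheaf of sections. -/
noncomputable def desc (ψ : P ⟶ (sections R S).obj E) : ofPresheaf P ⟶ E :=
  have hproj : ∀ a, E.obj.proj (descFun ψ a) = Germ.proj a := fun a => by
    obtain ⟨c, s, t, rfl⟩ := Germ.exists_rep a
    exact ((sectionOf ψ s).1 t).2
  ObjectProperty.homMk (show (Germ.sheaf P).Hom E.obj from
    { toFun := descFun ψ
      continuous_toFun := by
        refine (Germ.isOpenQuotientMap_mk P).continuous_comp_iff.1 (continuous_sigma fun i => ?_)
        exact (sectionOf ψ i.2).2.1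
      proj_toFun := hproj
      smul_toFun := fun g a => by
        obtain ⟨c, s, t, rfl⟩ := Germ.exists_rep a
        exact (sectionOf ψ s).2.2 g t
      add_toFun := fun x a b => by
        obtain ⟨c, t, h, s, s', rfl, rfl⟩ := Germ.exists_stalkMk₂ a b
        have h' := congrArg (fun v : E.obj.sections c.space => (v.1 t).1) (sectionOf_add ψ s s')
        refine (congrArg (descFun ψ)
          (congrArg Subtype.val (Germ.stalkMk_add t h s s').symm)).trans (h'.trans ?_)
        exact GSheaf.coe_add_congr rfl rfl
      const_smul_toFun := fun x r a => by
        obtain ⟨c, t, h, s, rfl⟩ := Germ.exists_stalkMk₁ a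
        have h' := congrArg (fun v : E.obj.sections c.space => (v.1 t).1) (sectionOf_smul ψ r s)
        refine (congrArg (descFun ψ)
          (congrArg Subtype.val (Germ.stalkMk_smul t h r s).symm)).trans (h'.trans ?_)
        exact GSheaf.coe_smul_congr r rfl })

variable (P E) in
/-- The universal property of the associated sheaf. -/
noncomputable def ofPresheafHomEquiv :
    (ofPresheaf P ⟶ E) ≃ (P ⟶ (sections R S).obj E) where
  toFun φ := toSections P ≫ (sections R S).map φ
  invFun ψ := desc ψ
  left_inv φ := by
    refine ObjectProperty.hom_ext _ (GSheaf.hom_ext_toFun fun a => ?_)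
    obtain ⟨c, s, t, rfl⟩ := Germ.exists_rep a
    rfl
  right_inv ψ := by
    ext c s
    exact GSheaf.sections_ext fun t => rfl

variable (R S) in
/-- The associated sheaf functor. -/
noncomputable def sheafification : ((Chart S)ᵒᵖ ⥤ ModuleCat.{u} R) ⥤ FixedSheaf R S :=
  Adjunction.leftAdjointOfEquiv (G := sections R S) (F_obj := ofPresheaf)
    (fun P E => ofPresheafHomEquiv P E)
    fun P E E' g h => by
      change toSections P ≫ (sections R S).map (h ≫ g) = (toSections P ≫ (sections R S).map h) ≫ _
      rw [Functor.map_comp, Category.assoc]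

variable (R S) in
/-- Sheafification is left adjoint to taking sections. -/
noncomputable def adjunction : sheafification R S ⊣ sections R S :=
  Adjunction.adjunctionOfEquivLeft _ _

theorem sheafification_map_mk (η : P ⟶ Q) {c : Chart S} (s : P.obj (op c)) (t : c.Pt) :
    GSheaf.Hom.toFun ((sheafification R S).map η).hom (Germ.mk s t) =
      Germ.mk (η.app (op c) s) t := rfl

/-- Injectivity: two sections with a common value at given points agree on a chart mapping to their
fibre product over `E`. Surjectivity: each point of `E` is hit by a chart, and the map from that
chart is itself a section. -/
instance : IsIso (adjunction R S).counit := by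
  refine @NatIso.isIso_of_isIso_app _ _ _ _ _ _ _ fun E => ?_
  suffices h : IsIso ((ObjectProperty.ι _).map ((adjunction R S).counit.app E)) from
    isIso_of_fully_faithful (ObjectProperty.ι _) _
  refine GSheaf.isIso_of_bijective _ ⟨fun a b hab => ?_, fun e => ?_⟩
  · obtain ⟨c, s, t, rfl⟩ := Germ.exists_rep a
    obtain ⟨d, s', t', rfl⟩ := Germ.exists_rep b
    obtain ⟨k, w, f, g, hf, hg, h⟩ := Chart.exists_pullback (S := S)
      (GSheaf.homOfSection (show E.obj.sections c.space from s))
      (GSheaf.homOfSection (show E.obj.sections d.space from s')) t t' hab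
    exact Germ.mk_eq_mk.2 ⟨k, w, f, g, hf, hg, GSheaf.sections_ext h⟩
  · obtain ⟨c, t, f, hf⟩ := HasCharts.exists_chart (S := S) E.obj.toEtale E.property.toEtale e
    exact ⟨Germ.mk (P := (sections R S).obj E) (GSheaf.sectionOfHom f) t, hf⟩

variable (R S) in
noncomputable instance : Reflective (sections R S) where
  toFull := (adjunction R S).fullyFaithfulROfIsIsoCounit.full
  toFaithful := (adjunction R S).fullyFaithfulROfIsIsoCounit.faithful
  L := sheafification R S
  adj := adjunction R S

variable (R S) in
theorem hasLimits : HasLimitsOfSize.{u, u} (FixedSheaf R S) :=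
  hasLimits_of_reflective (sections R S)

variable (R S) in
theorem hasColimits : HasColimitsOfSize.{u, u} (FixedSheaf R S) :=
  hasColimits_of_reflective (sections R S)

/-! ### Exactness of sheafification -/

attribute [local instance] GSheaf.preadditive

instance : (sections R S).Additive where
  map_add {E F f g} := by
    ext c s
    refine Subtype.ext (funext fun t => ?_)
    exact LinearMap.congr_fun (GSheaf.stalkMap_add f.hom g.hom _) _

instance : (sheafification R S).Additive := (adjunction R S).left_adjoint_additive

/-- Equal germs in `Q` become equal elements on a refinement, where `η` is injective. -/
theorem sheafification_map_injective (η : P ⟶ Q)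
    (hη : ∀ c, Function.Injective (η.app c)) :
    Function.Injective (GSheaf.Hom.toFun ((sheafification R S).map η).hom) := by
  intro a b hab
  obtain ⟨c, s, t, rfl⟩ := Germ.exists_rep a
  obtain ⟨d, s', t', rfl⟩ := Germ.exists_rep b
  rw [sheafification_map_mk, sheafification_map_mk] at hab
  obtain ⟨k, w, f, g, hf, hg, h⟩ := Germ.mk_eq_mk.1 hab
  refine Germ.mk_eq_mk.2 ⟨k, w, f, g, hf, hg, hη _ ?_⟩
  rwa [NatTrans.naturality_apply, NatTrans.naturality_apply]

/-- If the germ of `η s` vanishes, then `η` kills the restriction of `s` to a refinement, and there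
the restriction lifts to `K`. -/
theorem exists_of_sheafification_map_eq_zero {K : (Chart S)ᵒᵖ ⥤ ModuleCat.{u} R} (ι : K ⟶ P)
    (η : P ⟶ Q) (h : ∀ c s, η.app c s = 0 → ∃ k, ι.app c k = s) (a : Germ P)
    (ha : GSheaf.Hom.toFun ((sheafification R S).map η).hom a =
      (0 : (Germ.sheaf Q).Stalk (Germ.proj a)).1) :
    ∃ b, GSheaf.Hom.toFun ((sheafification R S).map ι).hom b = a := by
  obtain ⟨c, s, t, rfl⟩ := Germ.exists_rep a
  rw [sheafification_map_mk] at ha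
  obtain ⟨e, w, f, rfl, hf⟩ := Germ.mk_eq_mk_iff.1
    (ha.trans (congrArg Subtype.val (Germ.stalkMk_zero (P := Q) t rfl)).symm)
  rw [map_zero, ← NatTrans.naturality_apply] at hf
  obtain ⟨k, hk⟩ := h _ _ hf
  refine ⟨Germ.mk k w, ?_⟩
  rw [sheafification_map_mk, hk, Germ.mk_map]

/-- For an additive functor, left exactness only has to be checked on kernels. The kernel inclusion
stays injective on germs, and a map killed by the image of `f` takes values in its image, so
`GSheaf.exists_lift` factors it. -/
instance (f : P ⟶ Q) : PreservesLimit (parallelPair f 0) (sheafification R S) where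
  preserves {c} hc := by
    refine ⟨(KernelFork.isLimitMapConeEquiv c _).symm ?_⟩
    have hmono : Mono (Fork.ι c) := mono_of_isLimit_fork hc
    have hinj : Function.Injective
        (GSheaf.Hom.toFun ((sheafification R S).map (Fork.ι c)).hom) := by
      refine sheafification_map_injective _ fun d => ?_
      exact (ModuleCat.mono_iff_injective _).1 ((NatTrans.mono_iff_mono_app _).1 hmono d)
    have := mono_of_injective _ hinj
    refine KernelFork.IsLimit.ofι' ((sheafification R S).map (Fork.ι c))
      (by rw [← Functor.map_comp, KernelFork.condition, Functor.map_zero]) fun {A} k hk => ?_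
    have h := GSheaf.exists_lift ((sheafification R S).map (Fork.ι c)).hom hinj k.hom fun e => by
      refine exists_of_sheafification_map_eq_zero _ f (fun d s hs => ?_) _ ?_
      -- The element `s` is encoded as the map `r ↦ r • s` from `R`; the value at `1` of its lift to
      -- the kernel is the required preimage.
      · let l := KernelFork.IsLimit.lift' (KernelFork.mapIsLimit c hc ((evaluation _ _).obj d))
          (ModuleCat.ofHom (LinearMap.toSpanSingleton R _ s)) (by
            ext
            change f.app d ((1 : R) • s) = 0
            rw [one_smul, hs])
        refine ⟨l.1 (1 : R), ?_⟩
        exact (ConcreteCategory.congr_hom l.2 (1 : R)).trans (one_smul R s)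
      · refine (congrArg (fun k => GSheaf.Hom.toFun k.hom e) hk).trans ?_
        refine (GSheaf.zero_toFun e).trans (GSheaf.coe_zero_congr ?_)
        exact (GSheaf.Hom.proj_toFun k.hom e).symm
    exact ⟨ObjectProperty.homMk h.choose, ObjectProperty.hom_ext _ h.choose_spec⟩

variable (R S) in
/-- The category of `G`-sheaves on whose stalks over `x` the elements of `S x` act trivially is
abelian. -/
noncomputable abbrev abelian : Abelian (FixedSheaf R S) :=
  have := hasLimits R S
  have : HasFiniteProducts (FixedSheaf R S) := inferInstance
  have : HasZeroObject (FixedSheaf R S) := hasZeroObject_of_hasTerminal_object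
  have : PreservesFiniteLimits (sheafification R S) :=
    (sheafification R S).preservesFiniteLimits_of_preservesKernels
  abelianOfAdjunction (sections R S) (sheafification R S) (asIso (adjunction R S).counit)
    (adjunction R S)

end FixedSheaf

end

/-! ### Charts from equivariant sections over stable open sets -/

section

variable {G X : Type u} [Group G] [TopologicalSpace G] [TopologicalSpace X] [MulAction G X]
  [IsTopologicalGroup G] [ContinuousSMul G X]

/-- For an open subset `U` of `X` stable under an open subgroup `M`, the chart `G ×_M U`. -/
def Chart.induced {S : X → Set G} (hfix : ∀ x, ∀ k ∈ S x, k • x = x)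
    (hconj : ∀ (g : G) x k, k ∈ S (g • x) → g⁻¹ * k * g ∈ S x) (M : OpenSubgroup G) (U : Set X)
    (hU : IsOpen U) (hS : ∀ x ∈ U, ∀ k ∈ S x, k ∈ M) : Chart S where
  level := M
  domain := {p | ∃ g : G, p.1 = (g : G ⧸ M.toSubgroup) ∧ g⁻¹ • p.2 ∈ U}
  isOpen_domain := by
    rw [Set.ofPred_exists]
    refine isOpen_iUnion fun g => ?_
    exact ((isOpen_discrete {(g : G ⧸ M.toSubgroup)}).preimage continuous_fst).inter
      (hU.preimage (continuous_snd.const_smul g⁻¹))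
  smul_mem := by
    rintro a ⟨_, x⟩ ⟨g, rfl, hx⟩
    exact ⟨a * g, rfl, by simpa [mul_smul] using hx⟩
  fixed := by
    rintro ⟨_, x⟩ ⟨g, rfl, hx⟩ k hk
    refine Prod.ext ?_ (hfix x k hk)
    change ((k * g : G) : G ⧸ M.toSubgroup) = g
    -- `k` fixes the coset `gM` when `g⁻¹kg ∈ M`, and `g⁻¹kg` lies in `S (g⁻¹ • x)` with `g⁻¹ • x ∈
    -- U`.
    rw [eq_comm, QuotientGroup.eq, ← mul_assoc]
    exact hS _ hx _ (hconj g _ k (by rwa [smul_inv_smul]))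

/-- The section extends by `(gM, y) ↦ g • s (g⁻¹ • y)`, and the local section itself is recovered on
the trivial coset. -/
theorem exists_induced_hom {S : X → Set G} (hfix : ∀ x, ∀ k ∈ S x, k • x = x)
    (hconj : ∀ (g : G) x k, k ∈ S (g • x) → g⁻¹ * k * g ∈ S x) (M : OpenSubgroup G) (U : Set X)
    (hU : IsOpen U) (hS : ∀ x ∈ U, ∀ k ∈ S x, k ∈ M)
    (Y : EtaleGSpace G X) (s : X → Y.carrier) (hs : ContinuousOn s U)
    (hproj : ∀ x ∈ U, Y.proj (s x) = x) (hsm : ∀ m ∈ M, ∀ x ∈ U, s (m • x) = m • s x)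
    (x : X) (hx : x ∈ U) :
    ∃ (t : (Chart.induced hfix hconj M U hU hS).space.carrier)
      (f : EtaleGSpace.Hom (Chart.induced hfix hconj M U hU hS).space Y), f.toFun t = s x := by
  let D : Set ((G ⧸ M.toSubgroup) × X) :=
    {p | ∃ g : G, p.1 = (g : G ⧸ M.toSubgroup) ∧ g⁻¹ • p.2 ∈ U}
  let F : (G ⧸ M.toSubgroup) × X → Y.carrier := fun p => p.1.out • s (p.1.out⁻¹ • p.2)
  -- The chosen representative of `gM` is `g * m` with `m ∈ M`, and the equivariance of `s` under
  -- `M` absorbs `m`.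
  have hF : ∀ (g : G) (y : X), g⁻¹ • y ∈ U → F (g, y) = g • s (g⁻¹ • y) := by
    intro g y hy
    obtain ⟨m, hm⟩ := QuotientGroup.mk_out_eq_mul M.toSubgroup g
    change (g : G ⧸ M.toSubgroup).out • s ((g : G ⧸ M.toSubgroup).out⁻¹ • y) = _
    rw [hm, mul_inv_rev, mul_smul, mul_smul, hsm _ (inv_mem m.2) _ hy, smul_inv_smul]
  have hmem : ∀ p ∈ D, ∃ g : G, p.1 = g ∧ g⁻¹ • p.2 ∈ U := fun p hp => hp
  refine ⟨⟨((1 : G), x), 1, rfl, by simpa using hx⟩,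
    { toFun := fun p => F p.1
      continuous_toFun := ?_
      proj_toFun := ?_
      smul_toFun := ?_ }, ?_⟩
  · rw [continuous_iff_continuousAt]
    rintro ⟨p, hp⟩
    obtain ⟨g, hg, hgp⟩ := hmem p hp
    have hV : IsOpen {q : D | q.1.1 = g ∧ g⁻¹ • q.1.2 ∈ U} :=
      ((isOpen_discrete {(g : G ⧸ M.toSubgroup)}).preimage
        (continuous_fst.comp continuous_subtype_val)).inter
        (hU.preimage ((continuous_snd.comp continuous_subtype_val).const_smul g⁻¹))
    have h1 : ContinuousOn (fun q : D => g • s (g⁻¹ • q.1.2))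
        {q : D | q.1.1 = g ∧ g⁻¹ • q.1.2 ∈ U} :=
      (hs.comp (((continuous_snd.comp continuous_subtype_val).const_smul g⁻¹).continuousOn)
        fun q hq => hq.2).const_smul g
    refine (h1.congr fun q hq => ?_).continuousAt (hV.mem_nhds ⟨hg, hgp⟩)
    obtain ⟨⟨a, y⟩, _⟩ := q
    obtain ⟨rfl : a = g, hy⟩ := hq
    exact hF g y hy
  · rintro ⟨⟨a, y⟩, hp⟩
    obtain ⟨g, rfl : a = g, hy⟩ := hmem _ hp
    exact (congrArg Y.proj (hF g y hy)).trans (by rw [Y.proj_smul, hproj _ hy, smul_inv_smul]; rfl)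
  · rintro b ⟨⟨a, y⟩, hp⟩
    obtain ⟨g, rfl : a = g, hy⟩ := hmem _ hp
    have h2 : (b * g)⁻¹ • b • y = g⁻¹ • y := by rw [mul_inv_rev, mul_smul, inv_smul_smul]
    refine (hF (b * g) (b • y) (by rwa [h2])).trans ?_
    rw [h2, mul_smul]
    exact congrArg (b • ·) (hF g y hy).symm
  · refine (hF 1 x (by simpa using hx)).trans ?_
    simp

end

/-! ### Charts over the space of closed subgroups -/

namespace ClosedSubgroup

/-! ### Neighbourhoods of a closed subgroup -/

variable {G : Type u} [Group G] [TopologicalSpace G]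

theorem mem_basicOpen_self (N : OpenNormalSubgroup G) (K : ClosedSubgroup G) :
    K ∈ basicOpen N K := rfl

theorem isOpen_basicOpen (N : OpenNormalSubgroup G) (K : ClosedSubgroup G) :
    IsOpen (basicOpen N K) := TopologicalSpace.isOpen_generateFrom_of_mem ⟨N, K, rfl⟩

theorem basicOpen_subset_basicOpen {N N' : OpenNormalSubgroup G}
    (h : (N' : Subgroup G) ≤ N) (K : ClosedSubgroup G) : basicOpen N' K ⊆ basicOpen N K := by
  intro L hL
  have hL : (N' : Subgroup G) ⊔ L.toSubgroup = (N' : Subgroup G) ⊔ K.toSubgroup := hL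
  change (N : Subgroup G) ⊔ L.toSubgroup = (N : Subgroup G) ⊔ K.toSubgroup
  rw [← sup_eq_left.2 h, sup_assoc, sup_assoc, hL]

/-- The generating sets can be recentred at any of their points, and `N ⊓ N'` refines both `N` and
`N'`, so they form a basis. -/
theorem exists_basicOpen_subset {V : Set (ClosedSubgroup G)} (hV : IsOpen V)
    {K : ClosedSubgroup G} (hK : K ∈ V) : ∃ N : OpenNormalSubgroup G, basicOpen N K ⊆ V := by
  induction hV generalizing K with
  | basic U hU =>
    obtain ⟨N, K', rfl⟩ := hU
    exact ⟨N, fun L hL => Eq.trans hL hK⟩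
  | univ => exact ⟨⟨⊤, inferInstanceAs (⊤ : Subgroup G).Normal⟩, Set.subset_univ _⟩
  | inter U V _ _ hU hV =>
    obtain ⟨N, hN⟩ := hU hK.1
    obtain ⟨N', hN'⟩ := hV hK.2
    exact ⟨N ⊓ N', Set.subset_inter
      ((basicOpen_subset_basicOpen (N := N) (N' := N ⊓ N') (fun _ h => h.1) K).trans hN)
      ((basicOpen_subset_basicOpen (N := N') (N' := N ⊓ N') (fun _ h => h.2) K).trans hN')⟩
  | sUnion T _ hT =>
    obtain ⟨U, hU, hKU⟩ := hK
    obtain ⟨N, hN⟩ := hT U hU hKU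
    exact ⟨N, hN.trans (Set.subset_sUnion_of_mem hU)⟩

variable [IsTopologicalGroup G]

theorem sup_smul (N : OpenNormalSubgroup G) (g : G) (K : ClosedSubgroup G) :
    (N : Subgroup G) ⊔ (g • K).toSubgroup =
      ((N : Subgroup G) ⊔ K.toSubgroup).map (MulAut.conj g).toMonoidHom := by
  have hN : (N : Subgroup G).map (MulAut.conj g).toMonoidHom = N := by
    exact Subgroup.Normal.map_conj_eq _ g
  rw [Subgroup.map_sup, hN, smul_toSubgroup]

/-- Conjugation by an element of `NK` maps `NK` to itself. -/
theorem smul_mem_basicOpen {N : OpenNormalSubgroup G} {K L : ClosedSubgroup G} {m : G}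
    (hm : m ∈ (N : Subgroup G) ⊔ K.toSubgroup) (hL : L ∈ basicOpen N K) :
    m • L ∈ basicOpen N K := by
  have hL : (N : Subgroup G) ⊔ L.toSubgroup = (N : Subgroup G) ⊔ K.toSubgroup := hL
  change (N : Subgroup G) ⊔ (m • L).toSubgroup = (N : Subgroup G) ⊔ K.toSubgroup
  rw [sup_smul, hL]
  exact Subgroup.mem_normalizer_iff_map_conj_eq.1 (Subgroup.le_normalizer hm)

theorem smul_mem_basicOpen_smul {N : OpenNormalSubgroup G} {K L : ClosedSubgroup G} (g : G)
    (hL : L ∈ basicOpen N K) : g • L ∈ basicOpen N (g • K) := by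
  have hL : (N : Subgroup G) ⊔ L.toSubgroup = (N : Subgroup G) ⊔ K.toSubgroup := hL
  change (N : Subgroup G) ⊔ (g • L).toSubgroup = (N : Subgroup G) ⊔ (g • K).toSubgroup
  rw [sup_smul, sup_smul, hL]

instance : ContinuousSMul G (ClosedSubgroup G) where
  continuous_smul := by
    refine continuous_generateFrom_iff.2 ?_
    rintro _ ⟨N, K, rfl⟩
    rw [isOpen_iff_forall_mem_open]
    rintro ⟨g, L⟩ hgL
    have hgL : g • L ∈ basicOpen N K := hgL
    -- An element of `Ng` acts as `g` followed by an element of `N`, and conjugation by `N`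
    -- preserves `O(N, NK)`.
    refine ⟨{g' | g' * g⁻¹ ∈ (N : Subgroup G)} ×ˢ basicOpen N L, ?_, ?_, ?_, rfl⟩
    · rintro ⟨g', L'⟩ ⟨hg', hL'⟩
      have h1 : g • L' ∈ basicOpen N K := Eq.trans (smul_mem_basicOpen_smul g hL') hgL
      have h2 := smul_mem_basicOpen ((le_sup_left : (N : Subgroup G) ≤ _) hg') h1
      rwa [mul_smul, inv_smul_smul] at h2
    · exact IsOpen.prod (N.toOpenSubgroup.isOpen.preimage (by fun_prop)) (isOpen_basicOpen N L)
    · change g * g⁻¹ ∈ (N : Subgroup G)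
      rw [mul_inv_cancel]
      exact one_mem _

variable [CompactSpace G] [TotallyDisconnectedSpace G]

/-- Étale `G`-spaces over the space of closed subgroups have equivariant local sections. -/
theorem hasCharts (A : ClosedSubgroup G → Subgroup G) (hle : ∀ K, A K ≤ K.toSubgroup)
    (hclosed : ∀ K, IsClosed (A K : Set G))
    (hconj : ∀ (g : G) K k, k ∈ A (g • K) → g⁻¹ * k * g ∈ A K)
    (hsup : ∀ (N : OpenNormalSubgroup G) K, ∀ L ∈ basicOpen N K, A L ≤ (N : Subgroup G) ⊔ A K) :
    HasCharts fun K => (A K : Set G) where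
  smul_eq K k hk := smul_eq_self_of_mem (hle K hk)
  exists_chart Y hY y := by
    let K := Y.proj y
    obtain ⟨φ, hyφ, hφ⟩ := Y.isLocalHomeomorph y
    have hcont : Continuous fun z : G × Y.carrier => z.1 • z.2 := continuous_smul
    -- `A K` is compact and fixes `y`, so elements near `A K` keep points near `y` inside the domain
    -- of `φ`.
    obtain ⟨W, V, hW, hV, hKW, hyV, hWV⟩ := generalized_tube_lemma
      (s := (A K : Set G)) (hclosed K).isCompact
      (isCompact_singleton (x := y)) (φ.open_source.preimage hcont) (by
        rintro ⟨k, x⟩ ⟨hk, hx⟩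
        have hx : x = y := hx
        subst hx
        change k • x ∈ φ.source
        rwa [hY x k hk])
    obtain ⟨T, hT, hTW⟩ := compact_open_separated_mul_left (hclosed K).isCompact hW hKW
    obtain ⟨T', hTT', hT', hT1⟩ := mem_nhds_iff.1 hT
    obtain ⟨N₁, hN₁⟩ := ProfiniteGrp.exist_openNormalSubgroup_sub_open_nhds_of_one hT' hT1
    obtain ⟨N₂, hN₂⟩ := exists_basicOpen_subset
      (Y.isLocalHomeomorph.isOpenMap _ (hV.inter φ.open_source))
      (K := K) ⟨y, ⟨hyV rfl, hyφ⟩, rfl⟩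
    -- `N₁` puts `N·A(K)` inside `W`; `N₂` puts `O(N, NK)` inside the image of `V ∩ φ.source`.
    let N := N₁ ⊓ N₂
    have hNU : basicOpen N K ⊆ Y.proj '' (V ∩ φ.source) :=
      (basicOpen_subset_basicOpen (N := N₂) (N' := N) (fun _ h => h.2) K).trans hN₂
    have hs : ∀ L ∈ basicOpen N K, φ.symm L ∈ V ∧ φ.symm L ∈ φ.source ∧ Y.proj (φ.symm L) = L := by
      intro L hL
      obtain ⟨v, ⟨hv, hvφ⟩, rfl⟩ := hNU hL
      have : φ.symm (Y.proj v) = v := by rw [hφ]; exact φ.left_inv hvφ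
      rw [this]
      exact ⟨hv, hvφ, rfl⟩
    have hAM : (N : Subgroup G) ⊔ A K ≤ (N : Subgroup G) ⊔ K.toSubgroup := sup_le_sup_left (hle K) _
    -- `M` must lie in `W` for the section to be equivariant, yet contain `A L` for all `L` in `O(N,
    -- NK)` for the chart to be fixed; the latter is `hsup`.
    let M : OpenSubgroup G := ⟨(N : Subgroup G) ⊔ A K,
      Subgroup.isOpen_mono (le_sup_left : (N : Subgroup G) ≤ _) N.toOpenSubgroup.isOpen⟩
    obtain ⟨t, f, hf⟩ := exists_induced_hom (S := fun K => (A K : Set G))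
      (fun K k hk => smul_eq_self_of_mem (hle K hk)) hconj M
      (basicOpen N K) (isOpen_basicOpen N K) (fun L hL k hk => hsup N K L hL hk)
      Y φ.symm
      (φ.continuousOn_symm.mono fun L hL => by
        have h := φ.map_source (hs L hL).2.1
        rwa [← hφ, (hs L hL).2.2] at h)
      (fun L hL => (hs L hL).2.2)
      (fun m hm L hL => by
        have hmL := hs _ (smul_mem_basicOpen (hAM hm) hL)
        have hmW : m ∈ W := by
          obtain ⟨n, hn, a, ha, rfl⟩ := Subgroup.mem_sup_of_normal_left.1 hm
          exact hTW (Set.mul_mem_mul (hTT' (hN₁ hn.1)) ha)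
        have h1 : m • φ.symm L ∈ φ.source :=
          hWV (show (m, φ.symm L) ∈ W ×ˢ V from ⟨hmW, (hs L hL).1⟩)
        -- Both points lie in the domain of `φ`, over the same `m • L`.
        refine φ.injOn hmL.2.1 h1 ?_
        rw [← hφ, hmL.2.2, Y.proj_smul, (hs L hL).2.2])
      K (mem_basicOpen_self N K)
    refine ⟨_, t, f, hf.trans ?_⟩
    rw [show K = φ y from congrFun hφ y]
    exact φ.left_inv hyφ

instance hasCharts_weyl : HasCharts fun K : ClosedSubgroup G => (K : Set G) :=
  hasCharts (fun K => K.toSubgroup) (fun _ => le_rfl) (fun K => K.isClosed')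
    (fun g K k hk => (mem_smul_iff g K k).1 hk) fun N _ L hL =>
      (le_sup_right : L.toSubgroup ≤ (N : Subgroup G) ⊔ _).trans hL.le

/-- The trivial family imposes no condition on stalks, so this case covers all `G`-sheaves. -/
instance hasCharts_one [T2Space G] :
    HasCharts fun _ : ClosedSubgroup G => ((⊥ : Subgroup G) : Set G) :=
  hasCharts (fun _ => ⊥) (fun _ => bot_le)
    (fun _ => isClosed_singleton)
    (fun g _ k hk => by
      rw [Subgroup.mem_bot] at hk ⊢
      rw [hk, mul_one, inv_mul_cancel]) fun _ _ _ _ => bot_le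

end ClosedSubgroup

/-! ### Weyl sheaves -/

section

variable {G R : Type u} [Group G] [TopologicalSpace G] [IsTopologicalGroup G] [Ring R]

theorem GSheaf.isFixedBy_bot (E : GSheaf G R (ClosedSubgroup G)) :
    E.IsFixedBy fun _ => ((⊥ : Subgroup G) : Set G) := fun _ e k hk => by
  rw [Subgroup.mem_bot.1 hk, one_smul]

variable [CompactSpace G] [TotallyDisconnectedSpace G]

theorem GSheaf.hasLimits [T2Space G] :
    HasLimitsOfSize.{u, u} (GSheaf G R (ClosedSubgroup G)) := by
  let P : ObjectProperty (GSheaf G R (ClosedSubgroup G)) :=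
    GSheaf.IsFixedBy fun _ => ((⊥ : Subgroup G) : Set G)
  have : HasLimitsOfSize.{u, u} P.FullSubcategory :=
    FixedSheaf.hasLimits R fun _ : ClosedSubgroup G => ((⊥ : Subgroup G) : Set G)
  -- Every `G`-sheaf satisfies the condition for the trivial family, so the inclusion is an
  -- equivalence.
  have : P.ι.EssSurj := ⟨fun E => ⟨⟨E, E.isFixedBy_bot⟩, ⟨Iso.refl _⟩⟩⟩
  have : P.ι.IsEquivalence := {}
  exact Adjunction.has_limits_of_equivalence P.ι.inv

variable (G R) in
/-- The inclusion of Weyl sheaves is left adjoint to taking fixed points. -/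
def incWeylAdjunction : WeylSheaf.inc G R ⊣ weyl G R :=
  Adjunction.mkOfUnitCounit
    { unit :=
        { app := fun F => ObjectProperty.homMk (show F.obj.Hom F.obj.fixed from
            { toFun := fun e => ⟨e, fun k hk => F.property _ ⟨e, rfl⟩ k hk⟩
              continuous_toFun := continuous_id.subtype_mk _
              proj_toFun := fun _ => rfl
              smul_toFun := fun _ _ => rfl
              add_toFun := fun _ _ _ => rfl
              const_smul_toFun := fun _ _ _ => rfl }) }
      counit := { app := fun E => E.fixedIncl } }

theorem mono_fixedIncl (E : GSheaf G R (ClosedSubgroup G)) : Mono E.fixedIncl where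
  right_cancellation _ _ hgh := GSheaf.hom_ext_toFun fun e =>
    Subtype.ext (congrArg (fun k => GSheaf.Hom.toFun k e) hgh)

/-- The cone of fixed points of a limit cone of `G`-sheaves is a limit cone of Weyl sheaves. -/
def isLimitWeylCone {J : Type u} [SmallCategory J] {F : J ⥤ WeylSheaf G R}
    {c : Cone (F ⋙ WeylSheaf.inc G R)} (hc : IsLimit c) : IsLimit (weylCone c) where
  lift s := (incWeylAdjunction G R).homEquiv _ _ (hc.lift ((WeylSheaf.inc G R).mapCone s))
  fac s j := ObjectProperty.hom_ext _ (hc.fac ((WeylSheaf.inc G R).mapCone s) j)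
  uniq s m hm := by
    -- Uniqueness is checked on the transpose of `m`, a map of `G`-sheaves into the limit `c.pt`.
    refine (Equiv.symm_apply_eq ((incWeylAdjunction G R).homEquiv s.pt c.pt)).1 ?_
    exact hc.uniq ((WeylSheaf.inc G R).mapCone s) _ fun j =>
      congrArg (fun f => f.hom) (hm j)

end

theorem lemma10p7 (G R : Type u) [Group G] [TopologicalSpace G] [IsTopologicalGroup G]
    [CompactSpace G] [T2Space G] [TotallyDisconnectedSpace G] [Ring R] :
    -- the adjunction, with the inclusion of fixed points as counit
    (∃ adj : WeylSheaf.inc G R ⊣ weyl G R,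
      (∀ E : GSheaf G R (ClosedSubgroup G), adj.counit.app E = E.fixedIncl) ∧
      (∀ E : GSheaf G R (ClosedSubgroup G), Mono (adj.counit.app E)) ∧
      IsIso adj.unit ∧
      -- idempotence of the composite of `Weyl` and the inclusion
      (∀ E : GSheaf G R (ClosedSubgroup G),
        IsIso ((weyl G R ⋙ WeylSheaf.inc G R).map (adj.counit.app E)))) ∧
    (WeylSheaf.inc G R).Full ∧ (WeylSheaf.inc G R).Faithful ∧
    -- abelian, for the pointwise addition of maps
    (∃ _ : Abelian (WeylSheaf G R), ∀ (E F : WeylSheaf G R) (f g : E ⟶ F)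
      (K : ClosedSubgroup G), GSheaf.Hom.stalkMap (f + g).hom K =
        GSheaf.Hom.stalkMap f.hom K + GSheaf.Hom.stalkMap g.hom K) ∧
    -- all small limits and colimits
    HasLimitsOfSize.{u, u} (WeylSheaf G R) ∧ HasColimitsOfSize.{u, u} (WeylSheaf G R) ∧
    -- limits are `Weyl` applied to the limit of `G`-sheaves
    (∀ (J : Type u) [SmallCategory J] (F : J ⥤ WeylSheaf G R),
      HasLimit (F ⋙ WeylSheaf.inc G R) ∧
      ∀ c : Cone (F ⋙ WeylSheaf.inc G R), IsLimit c → Nonempty (IsLimit (weylCone c))) := by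
  -- The unit of a fully faithful left adjoint is invertible.
  have hunit : IsIso (incWeylAdjunction G R).unit := inferInstance
  refine ⟨⟨incWeylAdjunction G R, fun _ => rfl, mono_fixedIncl, hunit, fun E => ?_⟩,
    inferInstance, inferInstance,
    -- For the family `K ↦ K`, fixed sheaves are Weyl sheaves by definition; the transferred abelian
    -- structure keeps the stalkwise addition.
    ⟨FixedSheaf.abelian R fun K : ClosedSubgroup G => (K : Set G),
      fun E F f g K => GSheaf.stalkMap_add f.hom g.hom K⟩,
    FixedSheaf.hasLimits R fun K : ClosedSubgroup G => (K : Set G),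
    FixedSheaf.hasColimits R fun K : ClosedSubgroup G => (K : Set G),
    fun J _ F => ⟨?_, fun c hc => ⟨isLimitWeylCone hc⟩⟩⟩
  -- By the triangle identity, `Weyl` of the counit is a one-sided inverse of a component of the
  -- invertible unit.
  · rw [Functor.comp_map]
    infer_instance
  · have := GSheaf.hasLimits (G := G) (R := R)
    infer_instance
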